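/- Setting. There are $G\ge 1$ clients; client $g$ has weight $\alpha_g\ge 0$, $\sum_{g=1}^G\alpha_g=1$, and training samples $\widehat{\xi}_{g,n}=(\widehat{x}_{g,n},\widehat{y}_{g,n})\in\Xi:=\mathbb{R}^P\times\{-1,+1\}$, $n=1,\dots,N_g$, $N_g\ge 1$, with empirical distribution $\widehat{\mathbb{P}}_{g}$. Let $\|\cdot\|$ be a norm on $\mathbb{R}^P$ with dual norm $\|\cdot\|_*$, $\kappa_g\ge 0$, $\varepsilon_g\ge 0$, and $d_g((x,y),(x',y'))=\|x-x'\|+\kappa_g\mathbb{1}_{\{y\ne y'\}}$. Let $\mathcal{A}_g$ be the set of probability distributions $\mathbb{Q}$ on $\Xi$ whose type-1 Wasserstein distance to $\widehat{\mathbb{P}}_g$ with transportation cost $d_g$ is at most $\varepsilon_g$, and let $\mathcal{A}=\{\sum_g\alpha_g\mathbb{Q}_g:\mathbb{Q}_g\in\mathcal{A}_g\}$. Let $\ell_H(w;(x,y))=\max\{0,1-y\,w^{\mathsf T}x\}$. For $\tau_g>0$, the modified FDR-SVM problem is $$\inf_{w\in\mathbb{R}^P} F(w),\qquad F(w)=\sup_{\mathbb{Q}\in\mathcal{A}}\mathbb{E}^{\mathbb{Q}}[\ell_H(w;\xi)]+\sum_{g=1}^G\alpha_g\tau_g\|w\|_2^2,$$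 with consensus form $$\inf_{w_1,\dots,w_G,w}\ \sum_{g=1}^G\alpha_g\Big(\sup_{\mathbb{Q}_g\in\mathcal{A}_g}\mathbb{E}^{\mathbb{Q}_g}[\ell_H(w_g;\xi)]+\tau_g\|w_g\|_2^2\Big)\quad\text{subject to } w_g-w=0 \text{ for all } g.$$ Algorithm (ADMM-SC). Given a scale parameter $\rho>0$ and any $w^{(0)},w_g^{(0)},\mu_g^{(0)}$, in round $t$ each client takes for $w_g^{(t+1)}$ the $w_g$-part of a minimizer over $(w_g,\lambda_g,s)\in\mathbb{R}^P\times\mathbb{R}\times\mathbb{R}^{N_g}$ of $$\lambda_g\varepsilon_g+\frac1{N_g}\sum_{n=1}^{N_g}s_n+\frac{\rho}{2}\|w_g-w^{(t)}+\mu_g^{(t)}\|_2^2+\tau_g\|w_g\|_2^2$$ subject to $\ell_H(w_g;(\widehat{x}_{g,n},\widehat{y}_{g,n}))\le s_n$ and $\ell_H(w_g;(\widehat{x}_{g,n},-\widehat{y}_{g,n}))-\kappa_g\lambda_g\le s_n$ for all $n$, and $\lambda_g\ge\|w_g\|_*$. Then the server sets $w^{(t+1)}=\sum_g\alpha_g(w_g^{(t+1)}+\mu_g^{(t)})$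 and the clients set $\mu_g^{(t+1)}=\mu_g^{(t)}+w_g^{(t+1)}-w^{(t+1)}$. Theorem (ADMM-SC Convergence). Suppose $$\rho\le\min_{g=1,\dots,G-1}\left\{\frac{4\alpha_g\tau_g}{g(2G+1-g)},\ \frac{4\alpha_G\tau_G}{(G-1)(G+2)}\right\}$$ (for $G=1$ the right-hand side is read as $+\infty$). Then the algorithm can be run from every starting point, and for every run there is an optimal solution $w^*$ of the modified problem, with $(w^*,\dots,w^*,w^*)$ optimal for the consensus form, such that for every tolerance $\epsilon_1>0$ there is a $T$ with $\|w^{(t)}-w^*\|_2\le\epsilon_1$, $\|w_g^{(t)}-w^*\|_2\le\epsilon_1$ for all $g$, and $F(w^{(t)})\le F(w^*)+\epsilon_1$ for all $t\ge T$. -/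

import Mathlib

open MeasureTheory

open scoped ENNReal

noncomputable section

namespace FDRSVM

/-- Feature space `ℝ^P`; `‖·‖` on it is the Euclidean norm and `inner ℝ` the dot product. -/
abbrev Feature (P : ℕ) : Type := EuclideanSpace ℝ (Fin P)

/-- A sample `ξ = (x, y)`. The units of `ℤ` are exactly the two labels `-1` and `+1`. -/
abbrev Sample (P : ℕ) : Type := Feature P × ℤˣ

/-- The label set carries the discrete σ-algebra. -/
instance instMeasurableSingletonClassLabel : MeasurableSingletonClass ℤˣ where
  measurableSet_singleton y := by
    refine ⟨{(y : ℤ)}, MeasurableSet.singleton _, ?_⟩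
    ext z
    simp [Units.ext_iff]

/-- Hinge loss `max {0, 1 - y ⟨w, x⟩}`. -/
def hinge {P : ℕ} (w : Feature P) (ξ : Sample P) : ℝ :=
  max 0 (1 - ((ξ.2 : ℤ) : ℝ) * inner ℝ w ξ.1)

/-- Transportation cost `‖x - x'‖ + κ 1{y ≠ y'}` for a norm `ν` on `ℝ^P`. -/
def cost {P : ℕ} (ν : Seminorm ℝ (Feature P)) (κ : ℝ) (ξ ξ' : Sample P) : ℝ :=
  ν (ξ.1 - ξ'.1) + κ * (if ξ.2 ≠ ξ'.2 then 1 else 0)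

/-- The dual norm `sup {⟨w, x⟩ : ν x ≤ 1}`. -/
def dualNorm {P : ℕ} (ν : Seminorm ℝ (Feature P)) (w : Feature P) : ℝ :=
  sSup ((fun x : Feature P => inner ℝ w x) '' {x | ν x ≤ 1})

/-- Joint distributions with marginals `Q` and `Q'`. -/
def couplings {P : ℕ} (Q Q' : Measure (Sample P)) : Set (Measure (Sample P × Sample P)) :=
  {π | π.map Prod.fst = Q ∧ π.map Prod.snd = Q'}

/-- Type-1 Wasserstein distance with transportation cost `cost ν κ`. -/
def wasserstein {P : ℕ} (ν : Seminorm ℝ (Feature P)) (κ : ℝ) (Q Q' : Measure (Sample P)) :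
    ℝ≥0∞ :=
  ⨅ π ∈ couplings Q Q', ∫⁻ p, ENNReal.ofReal (cost ν κ p.1 p.2) ∂π

/-- Empirical distribution of `n` samples. -/
def empirical {P n : ℕ} (ξ : Fin n → Sample P) : Measure (Sample P) :=
  (n : ℝ≥0∞)⁻¹ • ∑ i, Measure.dirac (ξ i)

/-- Type-1 Wasserstein ball of radius `ε` around the empirical distribution. -/
def wassersteinBall {P n : ℕ} (ν : Seminorm ℝ (Feature P)) (κ ε : ℝ) (ξ : Fin n → Sample P) :
    Set (Measure (Sample P)) :=
  {Q | IsProbabilityMeasure Q ∧ wasserstein ν κ Q (empirical ξ) ≤ ENNReal.ofReal ε}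

/-- The data of a federated problem with `G` clients and `P` features. -/
structure Problem (G P : ℕ) where
  /-- number of samples of each client -/
  numSamples : Fin G → ℕ
  /-- local training sets -/
  sample : (g : Fin G) → Fin (numSamples g) → Sample P
  /-- client weights -/
  α : Fin G → ℝ
  /-- radii of the local Wasserstein balls -/
  ε : Fin G → ℝ
  /-- label-flipping costs -/
  κ : Fin G → ℝ
  /-- norm of the transportation cost -/
  ν : Seminorm ℝ (Feature P)

variable {G P : ℕ}

/-- Local ambiguity set of client `g`. -/
def Problem.localBall (p : Problem G P) (g : Fin G) : Set (Measure (Sample P)) :=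
  wassersteinBall p.ν (p.κ g) (p.ε g) (p.sample g)

/-- Mixture-of-Wasserstein-balls ambiguity set. -/
def Problem.mixtureBall (p : Problem G P) : Set (Measure (Sample P)) :=
  {Q | ∃ q : Fin G → Measure (Sample P), (∀ g, q g ∈ p.localBall g) ∧
    Q = ∑ g, ENNReal.ofReal (p.α g) • q g}

/-- Worst-case expected hinge loss over an ambiguity set (the loss is nonnegative, so the
expectation is taken in `[0, ∞]`). -/
def worstRisk (A : Set (Measure (Sample P))) (w : Feature P) : ℝ≥0∞ :=
  ⨆ Q ∈ A, ∫⁻ ξ, ENNReal.ofReal (hinge w ξ) ∂Q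

/-- Objective of the modified FDR-SVM problem
`inf_w sup_{Q ∈ A_G} E^Q[ℓ_H(w; ξ)] + ∑ g, α_g τ_g ‖w‖²`. -/
def Problem.modifiedObjective (p : Problem G P) (τ : Fin G → ℝ) (w : Feature P) : ℝ≥0∞ :=
  worstRisk p.mixtureBall w + ∑ g, ENNReal.ofReal (p.α g * (τ g * ‖w‖ ^ 2))

/-- Objective of the modified problem in consensus form, as a function of `((w_g)_g, w)`. -/
def Problem.consensusObjective (p : Problem G P) (τ : Fin G → ℝ)
    (z : (Fin G → Feature P) × Feature P) : ℝ≥0∞ :=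
  ∑ g, ENNReal.ofReal (p.α g) *
    (worstRisk (p.localBall g) (z.1 g) + ENNReal.ofReal (τ g * ‖z.1 g‖ ^ 2))

/-- Feasible set of the consensus form: `w_g - w = 0` for all clients. -/
def consensusSet (G P : ℕ) : Set ((Fin G → Feature P) × Feature P) :=
  {z | ∀ g, z.1 g - z.2 = 0}

/-- Feasible set of client `g`'s problem in the variables `(w_g, λ_g, s)`. -/
def Problem.clientSet (p : Problem G P) (g : Fin G) :
    Set (Feature P × ℝ × (Fin (p.numSamples g) → ℝ)) :=
  {z | (∀ n, hinge z.1 (p.sample g n) ≤ z.2.2 n) ∧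
    (∀ n, hinge z.1 ((p.sample g n).1, -(p.sample g n).2) - p.κ g * z.2.1 ≤ z.2.2 n) ∧
    dualNorm p.ν z.1 ≤ z.2.1}

/-- Strongly convex objective of client `g`'s problem in the variables `(w_g, λ_g, s)`, given the
global model `w` and the scaled multiplier `μ`. -/
def Problem.clientObjective (p : Problem G P) (τ : Fin G → ℝ) (ρ : ℝ) (g : Fin G)
    (w μ : Feature P) (z : Feature P × ℝ × (Fin (p.numSamples g) → ℝ)) : ℝ :=
  z.2.1 * p.ε g + 1 / (p.numSamples g : ℝ) * ∑ n, z.2.2 n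
    + ρ / 2 * ‖z.1 - w + μ‖ ^ 2 + τ g * ‖z.1‖ ^ 2

/-- `v` is the `w_g`-part of a minimizer of client `g`'s problem. -/
def Problem.IsClientUpdate (p : Problem G P) (τ : Fin G → ℝ) (ρ : ℝ) (g : Fin G)
    (w μ v : Feature P) : Prop :=
  ∃ (lam : ℝ) (s : Fin (p.numSamples g) → ℝ), (v, lam, s) ∈ p.clientSet g ∧
    IsMinOn (p.clientObjective τ ρ g w μ) (p.clientSet g) (v, lam, s)

/-- The sequences `w t`, `v t g`, `μ t g` (global model, local models, scaled multipliers) are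
iterates of the ADMM-SC algorithm. -/
structure Problem.IsADMMSC (p : Problem G P) (τ : Fin G → ℝ) (ρ : ℝ) (w : ℕ → Feature P)
    (v μ : ℕ → Fin G → Feature P) : Prop where
  client : ∀ t g, p.IsClientUpdate τ ρ g (w t) (μ t g) (v (t + 1) g)
  server : ∀ t, w (t + 1) = ∑ g, p.α g • (v (t + 1) g + μ t g)
  multiplier : ∀ t g, μ (t + 1) g = μ t g + v (t + 1) g - w (t + 1)

end FDRSVM

end

/-!
With scaled multipliers, ADMM-SC is two-block ADMM for the consensus problem with objective
`∑ g, α g * (f g (w g) + τ g * ‖w g‖²)` and constraint `w g = w`, in the inner product of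
`(ℝ^P)^G` weighted by `α`. Here `f g` is the worst-case hinge loss of client `g`. Such an
iteration converges for every `ρ > 0`; the bounds on `ρ` enter only because they force every weight
`α g` to be positive.

*Reformulation.* Eliminating the slack variables and the multiplier `λ ≥ ‖w‖_*` from a client's
problem leaves a convex function `Problem.robustLoss`, so a client update is a proximal step
(`isClientUpdate_iff`). By strong duality this function is the worst-case risk over the Wasserstein
ball (`worstRisk_localBall`). Weak duality is the pointwise bound `hinge_le_add_mul_cost` integrated
over a coupling. For the converse, complementary slackness (`exists_fraction_of_isMinOn`) tells
which fraction of each sample's mass has its label flipped, and the rest of the budget is spent on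
moving a vanishing mass very far in the steepest direction. The supremum over the mixtures splits
into the local suprema (`worstRisk_mixtureBall`), so both forms of the problem have the real
objective `Problem.regularizedLoss`.

*Convergence.* A minimizer `x` of this continuous coercive function exists, and separating convex
sets yields subgradients `y g` at `x` with `∑ g, α g • y g = 0`
(`exists_subgradients_sum_eq_zero`). The quantity
`∑ g, α g * ‖μ g + y g / ρ‖² + ‖w - x‖²` then decreases in every round after the first by at least a
multiple of `∑ g, α g * τ g * ‖v g - x‖²`, so all local models tend to `x`, and with them the global
one (`tendsto_of_consensus_iteration`). The objective values converge by continuity.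
-/

namespace FDRSVM

open Filter Topology

variable {G P : ℕ}

/-! ### A one-dimensional linear programming duality -/

theorem exists_isMinOn_Ici_penalized {N : ℕ} (a b : Fin N → ℝ) {κ ε L : ℝ} (hκ : 0 ≤ κ)
    (hε : 0 ≤ ε) (hL : 0 ≤ L) :
    ∃ l, L ≤ l ∧ ∀ l', L ≤ l' →
      l * ε + 1 / (N : ℝ) * ∑ n, max (a n) (b n - κ * l) ≤
        l' * ε + 1 / (N : ℝ) * ∑ n, max (a n) (b n - κ * l') := by
  rcases hκ.eq_or_lt with rfl | hκ
  · refine ⟨L, le_rfl, fun l' hl' => ?_⟩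
    simp only [zero_mul]
    gcongr
  -- Beyond `M` no term `b n - κ * l` exceeds `a n`, so the objective is nondecreasing there.
  obtain ⟨M, hLM, hM⟩ : ∃ M, L ≤ M ∧ ∀ n, b n - κ * M ≤ a n := by
    have hnn : ∀ n, 0 ≤ |b n - a n| / κ := fun n => by positivity
    refine ⟨L + ∑ n, |b n - a n| / κ, ?_, fun n => ?_⟩
    · linarith [Finset.sum_nonneg fun n (_ : n ∈ Finset.univ) => hnn n]
    · have h1 := Finset.single_le_sum (fun n _ => hnn n) (Finset.mem_univ n)
      rw [div_le_iff₀ hκ] at h1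
      nlinarith [le_abs_self (b n - a n), mul_nonneg hκ.le hL]
  obtain ⟨l, hl, hmin⟩ := (isCompact_Icc (a := L) (b := M)).exists_isMinOn ⟨L, le_rfl, hLM⟩
    (f := fun l => l * ε + 1 / (N : ℝ) * ∑ n, max (a n) (b n - κ * l)) (by fun_prop)
  refine ⟨l, hl.1, fun l' hl' => ?_⟩
  rcases le_total l' M with h | h
  · exact hmin ⟨hl', h⟩
  · refine (hmin ⟨hLM, le_rfl⟩).trans ?_
    dsimp only
    gcongr ?_ * ε + 1 / (N : ℝ) * ∑ n, ?_
    exact (max_eq_left (hM _)).trans_le (le_max_left _ _)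

/-- Complementary slackness for the fractional knapsack problem: at a minimizer `l` of the dual
objective over `[L, ∞)` there are fractions `θ n` that respect the budget and close the duality
gap. They are `1` where `b n - κ * l > a n`, `0` where `b n - κ * l < a n`, and in case of a tie
are chosen so that the budget is exhausted, unless `l` is the end point `L`. -/
theorem exists_fraction_of_isMinOn {N : ℕ} (a b : Fin N → ℝ) {κ ε L l : ℝ} (hl : L ≤ l)
    (hmin : ∀ l', L ≤ l' →
      l * ε + 1 / (N : ℝ) * ∑ n, max (a n) (b n - κ * l) ≤
        l' * ε + 1 / (N : ℝ) * ∑ n, max (a n) (b n - κ * l')) (hκ : 0 ≤ κ) :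
    ∃ θ : Fin N → ℝ, (∀ n, 0 ≤ θ n ∧ θ n ≤ 1) ∧ 0 ≤ ε - κ * (1 / (N : ℝ) * ∑ n, θ n) ∧
      l * ε + 1 / (N : ℝ) * ∑ n, max (a n) (b n - κ * l) =
        1 / (N : ℝ) * ∑ n, ((1 - θ n) * a n + θ n * b n) +
          L * (ε - κ * (1 / (N : ℝ) * ∑ n, θ n)) := by
  -- Any choice of `θ` on the optimal faces gives the value of the Lagrangian at `l`.
  have key : ∀ θ : Fin N → ℝ,
      (∀ n, max (a n) (b n - κ * l) = (1 - θ n) * a n + θ n * (b n - κ * l)) →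
      l * ε + 1 / (N : ℝ) * ∑ n, max (a n) (b n - κ * l) =
        1 / (N : ℝ) * ∑ n, ((1 - θ n) * a n + θ n * b n) +
          l * (ε - κ * (1 / (N : ℝ) * ∑ n, θ n)) := by
    intro θ hθ
    have : ∑ n, max (a n) (b n - κ * l) =
        ∑ n, ((1 - θ n) * a n + θ n * b n) - κ * l * ∑ n, θ n := by
      rw [Finset.mul_sum, ← Finset.sum_sub_distrib]
      exact Finset.sum_congr rfl fun n _ => by rw [hθ n]; ring
    rw [this]; ring
  set lo : Fin N → ℝ := fun n => if a n < b n - κ * l then 1 else 0 with hlo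
  set hi : Fin N → ℝ := fun n => if a n ≤ b n - κ * l then 1 else 0 with hhi
  have lo_face : ∀ n, max (a n) (b n - κ * l) = (1 - lo n) * a n + lo n * (b n - κ * l) := by
    intro n; simp only [hlo]; split_ifs with h
    · rw [max_eq_right h.le]; ring
    · rw [max_eq_left (not_lt.1 h)]; ring
  have hi_face : ∀ n, max (a n) (b n - κ * l) = (1 - hi n) * a n + hi n * (b n - κ * l) := by
    intro n; simp only [hhi]; split_ifs with h
    · rw [max_eq_right h]; ring
    · rw [max_eq_left (not_le.1 h).le]; ring
  have lo01 : ∀ n, 0 ≤ lo n ∧ lo n ≤ 1 := by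
    intro n; simp only [hlo]; split_ifs <;> norm_num
  have hi01 : ∀ n, 0 ≤ hi n ∧ hi n ≤ 1 := by
    intro n; simp only [hhi]; split_ifs <;> norm_num
  -- The right derivative of the objective at `l` is nonnegative.
  have right : 0 ≤ ε - κ * (1 / (N : ℝ) * ∑ n, lo n) := by
    have ev : ∀ᶠ h in 𝓝[>] (0 : ℝ), ∀ n,
        max (a n) (b n - κ * (l + h)) ≤ max (a n) (b n - κ * l) - κ * h * lo n := by
      rw [eventually_all]
      intro n
      by_cases h : a n < b n - κ * l
      · have hc : Tendsto (fun t : ℝ => b n - κ * (l + t)) (𝓝[>] 0) (𝓝 (b n - κ * (l + 0))) :=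
          ((by fun_prop : Continuous fun t : ℝ => b n - κ * (l + t)).tendsto 0).mono_left
            nhdsWithin_le_nhds
        filter_upwards [hc.eventually (lt_mem_nhds (by simpa using h))] with t ht
        rw [max_eq_right ht.le, max_eq_right h.le]
        simp only [hlo, if_pos h]
        linarith
      · filter_upwards [self_mem_nhdsWithin] with t ht
        have : 0 ≤ κ * t := mul_nonneg hκ (le_of_lt ht)
        simp only [hlo, if_neg h]
        rw [mul_zero, sub_zero]
        exact max_le_max le_rfl (by linarith)
    obtain ⟨h, hh, hpos⟩ := (ev.and self_mem_nhdsWithin).exists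
    replace hpos : 0 < h := hpos
    have h1 := hmin (l + h) (by linarith)
    have h2 : ∑ n, max (a n) (b n - κ * (l + h)) ≤
        ∑ n, max (a n) (b n - κ * l) - κ * h * ∑ n, lo n := by
      rw [Finset.mul_sum, ← Finset.sum_sub_distrib]
      exact Finset.sum_le_sum fun n _ => hh n
    have h3 := mul_le_mul_of_nonneg_left h2 (by positivity : 0 ≤ 1 / (N : ℝ))
    have h4 : 0 ≤ h * (ε - κ * (1 / (N : ℝ) * ∑ n, lo n)) := by linarith
    exact nonneg_of_mul_nonneg_right h4 hpos
  rcases hl.eq_or_lt with rfl | hlt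
  · exact ⟨lo, lo01, right, key lo lo_face⟩
  -- The left derivative of the objective at `l` is nonpositive.
  have left : ε - κ * (1 / (N : ℝ) * ∑ n, hi n) ≤ 0 := by
    have ev : ∀ᶠ h in 𝓝[>] (0 : ℝ), ∀ n,
        max (a n) (b n - κ * (l - h)) ≤ max (a n) (b n - κ * l) + κ * h * hi n := by
      rw [eventually_all]
      intro n
      by_cases h : a n ≤ b n - κ * l
      · filter_upwards [self_mem_nhdsWithin] with t ht
        have : 0 ≤ κ * t := mul_nonneg hκ (le_of_lt ht)
        rw [max_eq_right h]
        simp only [hhi, if_pos h]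
        exact max_le (by linarith) (by linarith)
      · have hc : Tendsto (fun t : ℝ => b n - κ * (l - t)) (𝓝[>] 0) (𝓝 (b n - κ * (l - 0))) :=
          ((by fun_prop : Continuous fun t : ℝ => b n - κ * (l - t)).tendsto 0).mono_left
            nhdsWithin_le_nhds
        filter_upwards [hc.eventually (gt_mem_nhds (by simpa using h))] with t ht
        rw [max_eq_left ht.le]
        simp only [hhi, if_neg h]
        rw [mul_zero, add_zero]
        exact le_max_left _ _
    have ev' : ∀ᶠ h in 𝓝[>] (0 : ℝ), h < l - L :=
      nhdsWithin_le_nhds (gt_mem_nhds (by linarith))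
    obtain ⟨h, ⟨hh, hhL⟩, hpos⟩ := ((ev.and ev').and self_mem_nhdsWithin).exists
    replace hpos : 0 < h := hpos
    have h1 := hmin (l - h) (by linarith)
    have h2 : ∑ n, max (a n) (b n - κ * (l - h)) ≤
        ∑ n, max (a n) (b n - κ * l) + κ * h * ∑ n, hi n := by
      rw [Finset.mul_sum, ← Finset.sum_add_distrib]
      exact Finset.sum_le_sum fun n _ => hh n
    have h3 := mul_le_mul_of_nonneg_left h2 (by positivity : 0 ≤ 1 / (N : ℝ))
    have h4 : h * (ε - κ * (1 / (N : ℝ) * ∑ n, hi n)) ≤ 0 := by linarith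
    by_contra hcon
    exact absurd h4 (not_le.2 (mul_pos hpos (not_le.1 hcon)))
  -- Interpolate between the two extreme choices so that the budget is exhausted.
  obtain ⟨t, ht0, ht1, ht⟩ : ∃ t : ℝ, 0 ≤ t ∧ t ≤ 1 ∧
      ε - κ * (1 / (N : ℝ) * ∑ n, ((1 - t) * lo n + t * hi n)) = 0 := by
    have hc : ContinuousOn
        (fun t : ℝ => ε - κ * (1 / (N : ℝ) * ∑ n, ((1 - t) * lo n + t * hi n)))
        (Set.Icc 0 1) := by fun_prop
    obtain ⟨t, ht, h⟩ := intermediate_value_Icc' zero_le_one hc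
      (show (0 : ℝ) ∈ _ from ⟨by simpa using left, by simpa using right⟩)
    exact ⟨t, ht.1, ht.2, h⟩
  refine ⟨fun n => (1 - t) * lo n + t * hi n, fun n => ⟨?_, ?_⟩, ht.ge, ?_⟩
  · nlinarith [mul_nonneg (sub_nonneg.2 ht1) (lo01 n).1, mul_nonneg ht0 (hi01 n).1]
  · nlinarith [mul_le_mul_of_nonneg_left (lo01 n).2 (sub_nonneg.2 ht1),
      mul_le_mul_of_nonneg_left (hi01 n).2 ht0]
  · rw [key _ fun n => ?_, ht, mul_zero, mul_zero]
    linear_combination (1 - t) * lo_face n + t * hi_face n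

/-! ### The dual norm -/

theorem continuous_seminorm (ν : Seminorm ℝ (Feature P)) : Continuous ν :=
  continuousOn_univ.1 (ν.convexOn.continuousOn isOpen_univ)

theorem exists_pos_mul_norm_le {ν : Seminorm ℝ (Feature P)} (hν : ∀ x, ν x = 0 → x = 0) :
    ∃ c : ℝ, 0 < c ∧ ∀ x, c * ‖x‖ ≤ ν x := by
  rcases (Metric.sphere (0 : Feature P) 1).eq_empty_or_nonempty with he | hne
  · refine ⟨1, one_pos, fun x => ?_⟩
    by_contra hx
    have hx0 : x ≠ 0 := by rintro rfl; simp at hx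
    have : ‖x‖⁻¹ • x ∈ Metric.sphere (0 : Feature P) 1 := by
      simp [norm_smul, hx0]
    simp [he] at this
  · obtain ⟨u, hu, hmin⟩ := (isCompact_sphere (0 : Feature P) 1).exists_isMinOn hne
      (continuous_seminorm ν).continuousOn
    have hu1 : ‖u‖ = 1 := by simpa using hu
    refine ⟨ν u, ?_, fun x => ?_⟩
    · refine lt_of_le_of_ne (apply_nonneg ν u) fun h => ?_
      rw [hν u h.symm] at hu1
      simp at hu1
    · rcases eq_or_ne x 0 with rfl | hx
      · simp
      have hx' : 0 < ‖x‖ := norm_pos_iff.2 hx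
      have h := hmin (show ‖x‖⁻¹ • x ∈ Metric.sphere (0 : Feature P) 1 by
        simp [norm_smul, hx])
      simp only [Set.mem_ofPred_eq, map_smul_eq_mul, norm_inv, norm_norm] at h
      rwa [inv_mul_eq_div, le_div_iff₀ hx'] at h

theorem isCompact_unitBall {ν : Seminorm ℝ (Feature P)} (hν : ∀ x, ν x = 0 → x = 0) :
    IsCompact {x | ν x ≤ 1} := by
  obtain ⟨c, hc, h⟩ := exists_pos_mul_norm_le hν
  refine Metric.isCompact_of_isClosed_isBounded
    (isClosed_le (continuous_seminorm ν) continuous_const) ?_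
  refine isBounded_iff_forall_norm_le.2 ⟨1 / c, fun x hx => ?_⟩
  rw [le_div_iff₀ hc, mul_comm]
  exact (h x).trans hx

theorem exists_inner_eq_dualNorm {ν : Seminorm ℝ (Feature P)} (hν : ∀ x, ν x = 0 → x = 0)
    (w : Feature P) : ∃ u, ν u ≤ 1 ∧ inner ℝ w u = dualNorm ν w := by
  obtain ⟨u, hu, h⟩ := (isCompact_unitBall hν).exists_sSup_image_eq
    ⟨0, by simp⟩ (f := fun x : Feature P => inner ℝ w x) (by fun_prop)
  exact ⟨u, hu, h.symm⟩

theorem inner_le_dualNorm {ν : Seminorm ℝ (Feature P)} (hν : ∀ x, ν x = 0 → x = 0)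
    (w : Feature P) {u : Feature P} (hu : ν u ≤ 1) : inner ℝ w u ≤ dualNorm ν w :=
  le_csSup ((isCompact_unitBall hν).image (by fun_prop)).bddAbove ⟨u, hu, rfl⟩

theorem dualNorm_nonneg {ν : Seminorm ℝ (Feature P)} (hν : ∀ x, ν x = 0 → x = 0)
    (w : Feature P) : 0 ≤ dualNorm ν w := by
  simpa using inner_le_dualNorm hν w (u := 0) (by simp)

theorem inner_le_dualNorm_mul {ν : Seminorm ℝ (Feature P)} (hν : ∀ x, ν x = 0 → x = 0)
    (w x : Feature P) : inner ℝ w x ≤ dualNorm ν w * ν x := by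
  rcases (apply_nonneg ν x).eq_or_lt with h | h
  · simp [hν x h.symm]
  · have := inner_le_dualNorm hν w (u := (ν x)⁻¹ • x) (by
      rw [map_smul_eq_mul, norm_inv, Real.norm_of_nonneg h.le, inv_mul_cancel₀ h.ne'])
    rw [inner_smul_right, inv_mul_eq_div, div_le_iff₀ h] at this
    exact this

theorem convexOn_dualNorm {ν : Seminorm ℝ (Feature P)} (hν : ∀ x, ν x = 0 → x = 0) :
    ConvexOn ℝ Set.univ (dualNorm ν) := by
  refine ⟨convex_univ, fun x _ y _ a b ha hb _ => ?_⟩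
  obtain ⟨u, hu, h⟩ := exists_inner_eq_dualNorm hν (a • x + b • y)
  rw [← h, inner_add_left, inner_smul_left, inner_smul_left]
  simp only [conj_trivial, smul_eq_mul]
  gcongr <;> exact inner_le_dualNorm hν _ hu

/-! ### The hinge loss -/

theorem hinge_nonneg (w : Feature P) (ξ : Sample P) : 0 ≤ hinge w ξ := le_max_left _ _

theorem convexOn_hinge (ξ : Sample P) : ConvexOn ℝ Set.univ fun w => hinge w ξ := by
  refine ⟨convex_univ, fun x _ y _ a b ha hb hab => ?_⟩
  refine max_le ?_ ?_
  · have := hinge_nonneg x ξ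
    have := hinge_nonneg y ξ
    simp only [smul_eq_mul]
    positivity
  · have h1 : 1 - ((ξ.2 : ℤ) : ℝ) * inner ℝ x ξ.1 ≤ hinge x ξ := le_max_right _ _
    have h2 : 1 - ((ξ.2 : ℤ) : ℝ) * inner ℝ y ξ.1 ≤ hinge y ξ := le_max_right _ _
    rw [inner_add_left, inner_smul_left, inner_smul_left]
    simp only [conj_trivial, smul_eq_mul]
    linear_combination a * h1 + b * h2 - hab

theorem abs_label (y : ℤˣ) : |((y : ℤ) : ℝ)| = 1 := by
  rcases Int.units_eq_one_or y with rfl | rfl <;> simp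

theorem label_mul_self (y : ℤˣ) : ((y : ℤ) : ℝ) * ((y : ℤ) : ℝ) = 1 := by
  rcases Int.units_eq_one_or y with rfl | rfl <;> simp

theorem hinge_le_hinge_add {ν : Seminorm ℝ (Feature P)} (hν : ∀ x, ν x = 0 → x = 0)
    (w x x' : Feature P) (y : ℤˣ) :
    hinge w (x, y) ≤ hinge w (x', y) + dualNorm ν w * ν (x - x') := by
  have h0 : 0 ≤ dualNorm ν w * ν (x - x') :=
    mul_nonneg (dualNorm_nonneg hν w) (apply_nonneg ν _)
  refine max_le (add_nonneg (hinge_nonneg _ _) h0) ?_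
  have h1 : 1 - ((y : ℤ) : ℝ) * inner ℝ w x' ≤ hinge w (x', y) := le_max_right _ _
  have h2 := inner_le_dualNorm_mul hν w (-(((y : ℤ) : ℝ) • (x - x')))
  rw [map_neg_eq_map, map_smul_eq_mul, Real.norm_eq_abs, abs_label, one_mul, inner_neg_right,
    inner_smul_right, inner_sub_right] at h2
  dsimp only
  linarith

theorem measurable_hinge (w : Feature P) : Measurable (hinge w) := by
  have h1 : Measurable fun ξ : Sample P => ((ξ.2 : ℤ) : ℝ) :=
    (measurable_of_countable fun y : ℤˣ => ((y : ℤ) : ℝ)).comp measurable_snd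
  have h2 : Measurable fun ξ : Sample P => (inner ℝ w ξ.1 : ℝ) :=
    (by fun_prop : Continuous fun x : Feature P => (inner ℝ w x : ℝ)).measurable.comp
      measurable_fst
  exact measurable_const.max (measurable_const.sub (h1.mul h2))

theorem measurable_cost (ν : Seminorm ℝ (Feature P)) (κ : ℝ) :
    Measurable fun q : Sample P × Sample P => cost ν κ q.1 q.2 := by
  have h1 : Measurable fun q : Sample P × Sample P => ν (q.1.1 - q.2.1) :=
    (continuous_seminorm ν).measurable.comp
      ((measurable_fst.comp measurable_fst).sub (measurable_fst.comp measurable_snd))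
  have h2 : Measurable fun q : Sample P × Sample P => (if q.1.2 ≠ q.2.2 then (1 : ℝ) else 0) :=
    (measurable_of_countable fun y : ℤˣ × ℤˣ => if y.1 ≠ y.2 then (1 : ℝ) else 0).comp
      ((measurable_snd.comp measurable_fst).prodMk (measurable_snd.comp measurable_snd))
  exact h1.add (h2.const_mul κ)

theorem cost_nonneg (ν : Seminorm ℝ (Feature P)) {κ : ℝ} (hκ : 0 ≤ κ) (ξ ξ' : Sample P) :
    0 ≤ cost ν κ ξ ξ' := by
  unfold cost
  have := apply_nonneg ν (ξ.1 - ξ'.1)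
  split_ifs <;> linarith

/-! ### The robust loss of a client -/

/-- The sign conditions on the data of a problem, and that `ν` is a norm. -/
structure Problem.IsRegular (p : Problem G P) : Prop where
  numSamples_pos : ∀ g, 0 < p.numSamples g
  ε_nonneg : ∀ g, 0 ≤ p.ε g
  κ_nonneg : ∀ g, 0 ≤ p.κ g
  norm_definite : ∀ x, p.ν x = 0 → x = 0

/-- Objective of client `g`'s problem without its quadratic terms, as a function of the multiplier
`l` of the Wasserstein constraint, with every `s n` at its least feasible value. -/
noncomputable def Problem.dualObjective (p : Problem G P) (g : Fin G) (w : Feature P) (l : ℝ) :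
    ℝ :=
  l * p.ε g + 1 / (p.numSamples g : ℝ) *
    ∑ n, max (hinge w (p.sample g n))
      (hinge w ((p.sample g n).1, -(p.sample g n).2) - p.κ g * l)

/-- The partial minimum of `dualObjective` over the multipliers `l ≥ ‖w‖_*`. -/
noncomputable def Problem.robustLoss (p : Problem G P) (g : Fin G) (w : Feature P) : ℝ :=
  sInf (p.dualObjective g w '' Set.Ici (dualNorm p.ν w))

variable {p : Problem G P} {g : Fin G} {w : Feature P}

theorem Problem.IsRegular.dualObjective_nonneg (hp : p.IsRegular) {l : ℝ}
    (hl : dualNorm p.ν w ≤ l) : 0 ≤ p.dualObjective g w l := by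
  have h0 : 0 ≤ l := (dualNorm_nonneg hp.norm_definite w).trans hl
  refine add_nonneg (mul_nonneg h0 (hp.ε_nonneg g)) (mul_nonneg (by positivity) ?_)
  exact Finset.sum_nonneg fun n _ => (hinge_nonneg _ _).trans (le_max_left _ _)

theorem Problem.IsRegular.robustLoss_le (hp : p.IsRegular) {l : ℝ} (hl : dualNorm p.ν w ≤ l) :
    p.robustLoss g w ≤ p.dualObjective g w l :=
  csInf_le ⟨0, by rintro _ ⟨l, hl, rfl⟩; exact hp.dualObjective_nonneg hl⟩ ⟨l, hl, rfl⟩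

theorem Problem.IsRegular.exists_robustLoss_eq (hp : p.IsRegular) (g : Fin G) (w : Feature P) :
    ∃ l, dualNorm p.ν w ≤ l ∧ p.robustLoss g w = p.dualObjective g w l := by
  obtain ⟨l, hl, hmin⟩ := exists_isMinOn_Ici_penalized
    (fun n => hinge w (p.sample g n))
    (fun n => hinge w ((p.sample g n).1, -(p.sample g n).2)) (hp.κ_nonneg g) (hp.ε_nonneg g)
    (dualNorm_nonneg hp.norm_definite w)
  refine ⟨l, hl, IsLeast.csInf_eq ⟨⟨l, hl, rfl⟩, ?_⟩⟩
  rintro _ ⟨l', hl', rfl⟩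
  exact hmin l' hl'

theorem Problem.IsRegular.robustLoss_nonneg (hp : p.IsRegular) (g : Fin G) (w : Feature P) :
    0 ≤ p.robustLoss g w := by
  obtain ⟨l, hl, h⟩ := hp.exists_robustLoss_eq g w
  exact h ▸ hp.dualObjective_nonneg hl

/-- The robust loss is a partial minimum of a jointly convex function. -/
theorem Problem.IsRegular.convexOn_robustLoss (hp : p.IsRegular) (g : Fin G) :
    ConvexOn ℝ Set.univ (p.robustLoss g) := by
  refine ⟨convex_univ, fun x _ y _ a b ha hb hab => ?_⟩
  obtain ⟨l, hl, hx⟩ := hp.exists_robustLoss_eq g x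
  obtain ⟨m, hm, hy⟩ := hp.exists_robustLoss_eq g y
  have hlm : dualNorm p.ν (a • x + b • y) ≤ a * l + b * m := by
    refine ((convexOn_dualNorm hp.norm_definite).2 trivial trivial ha hb hab).trans ?_
    simp only [smul_eq_mul]
    gcongr
  refine (hp.robustLoss_le hlm).trans ?_
  rw [hx, hy]
  simp only [smul_eq_mul, Problem.dualObjective]
  have key : ∑ n, max (hinge (a • x + b • y) (p.sample g n))
        (hinge (a • x + b • y) ((p.sample g n).1, -(p.sample g n).2) - p.κ g * (a * l + b * m)) ≤
      a * ∑ n, max (hinge x (p.sample g n))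
        (hinge x ((p.sample g n).1, -(p.sample g n).2) - p.κ g * l) +
      b * ∑ n, max (hinge y (p.sample g n))
        (hinge y ((p.sample g n).1, -(p.sample g n).2) - p.κ g * m) := by
    rw [Finset.mul_sum, Finset.mul_sum, ← Finset.sum_add_distrib]
    refine Finset.sum_le_sum fun n _ => max_le ?_ ?_
    · refine ((convexOn_hinge _).2 trivial trivial ha hb hab).trans ?_
      simp only [smul_eq_mul]
      gcongr <;> exact le_max_left _ _
    · have h1 := (convexOn_hinge ((p.sample g n).1, -(p.sample g n).2)).2
        (Set.mem_univ x) (Set.mem_univ y) ha hb hab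
      simp only [smul_eq_mul] at h1
      have h2 := mul_le_mul_of_nonneg_left (le_max_right (hinge x (p.sample g n))
        (hinge x ((p.sample g n).1, -(p.sample g n).2) - p.κ g * l)) ha
      have h3 := mul_le_mul_of_nonneg_left (le_max_right (hinge y (p.sample g n))
        (hinge y ((p.sample g n).1, -(p.sample g n).2) - p.κ g * m)) hb
      linarith
  have := mul_le_mul_of_nonneg_left key (by positivity : 0 ≤ 1 / (p.numSamples g : ℝ))
  linarith

theorem Problem.IsRegular.continuous_robustLoss (hp : p.IsRegular) (g : Fin G) :
    Continuous (p.robustLoss g) :=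
  continuousOn_univ.1 ((hp.convexOn_robustLoss g).continuousOn isOpen_univ)

/-! ### Strong duality for the Wasserstein ball -/

theorem lintegral_empirical {n : ℕ} (ξ : Fin n → Sample P) {f : Sample P → ℝ≥0∞}
    (hf : Measurable f) : ∫⁻ x, f x ∂(empirical ξ) = (n : ℝ≥0∞)⁻¹ * ∑ i, f (ξ i) := by
  simp [empirical, lintegral_smul_measure, lintegral_finsetSum_measure, lintegral_dirac' _ hf]

theorem ofReal_one_div_mul_sum {n : ℕ} (hn : 0 < n) {f : Fin n → ℝ} (hf : ∀ i, 0 ≤ f i) :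
    ENNReal.ofReal (1 / (n : ℝ) * ∑ i, f i) = (n : ℝ≥0∞)⁻¹ * ∑ i, ENNReal.ofReal (f i) := by
  rw [ENNReal.ofReal_mul (by positivity), one_div, ENNReal.ofReal_inv_of_pos (by exact_mod_cast hn),
    ENNReal.ofReal_natCast, ENNReal.ofReal_sum_of_nonneg fun i _ => hf i]

/-- Moving a sample raises the hinge loss by at most `l` times the transportation cost, once the
option of flipping the label is charged to the reference point. -/
theorem hinge_le_add_mul_cost {ν : Seminorm ℝ (Feature P)} (hν : ∀ x, ν x = 0 → x = 0)
    (w : Feature P) (κ : ℝ) {l : ℝ} (hl : dualNorm ν w ≤ l) (ξ ξ' : Sample P) :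
    hinge w ξ ≤ max (hinge w ξ') (hinge w (ξ'.1, -ξ'.2) - κ * l) + l * cost ν κ ξ ξ' := by
  obtain ⟨x, y⟩ := ξ
  obtain ⟨x', y'⟩ := ξ'
  have h1 := hinge_le_hinge_add hν w x x' y
  have h2 : dualNorm ν w * ν (x - x') ≤ l * ν (x - x') := by gcongr
  by_cases hy : y = y'
  · subst hy
    have h3 := le_max_left (hinge w (x', y)) (hinge w (x', -y) - κ * l)
    simp only [cost, ne_eq, not_true_eq_false, if_false]
    linarith
  · have h3 := le_max_right (hinge w (x', y')) (hinge w (x', -y') - κ * l)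
    have h4 : y = -y' := by
      rcases Int.units_eq_one_or y with rfl | rfl <;>
        rcases Int.units_eq_one_or y' with rfl | rfl <;> simp_all
    simp only [cost, ne_eq, hy, not_false_eq_true, if_true]
    rw [← h4] at h3 ⊢
    linarith

theorem Problem.IsRegular.worstRisk_localBall_le (hp : p.IsRegular) {l : ℝ}
    (hl : dualNorm p.ν w ≤ l) :
    worstRisk (p.localBall g) w ≤ ENNReal.ofReal (p.dualObjective g w l) := by
  refine iSup₂_le fun Q hQ => ?_
  obtain ⟨-, hQ⟩ := hQ
  have hl0 : 0 ≤ l := (dualNorm_nonneg hp.norm_definite w).trans hl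
  set S : Sample P → ℝ :=
    fun ξ => max (hinge w ξ) (hinge w (ξ.1, -ξ.2) - p.κ g * l) with hS
  have hS0 : ∀ ξ, 0 ≤ S ξ := fun ξ => (hinge_nonneg _ _).trans (le_max_left _ _)
  have hSm : Measurable S := by
    refine (measurable_hinge w).max (Measurable.sub_const ((measurable_hinge w).comp ?_) _)
    exact measurable_fst.prodMk
      ((measurable_of_countable fun y : ℤˣ => -y).comp measurable_snd)
  -- The distance is an infimum, so some coupling is within `η` of the radius.
  have step : ∀ η : ℝ, 0 < η → ∫⁻ ξ, ENNReal.ofReal (hinge w ξ) ∂Q ≤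
      ENNReal.ofReal (p.dualObjective g w l + l * η) := by
    intro η hη
    have hlt : wasserstein p.ν (p.κ g) Q (empirical (p.sample g)) <
        ENNReal.ofReal (p.ε g + η) :=
      hQ.trans_lt ((ENNReal.ofReal_lt_ofReal_iff (by linarith [hp.ε_nonneg g])).2 (by linarith))
    obtain ⟨π, hπ⟩ := iInf_lt_iff.1 hlt
    obtain ⟨⟨h1, h2⟩, hπ⟩ := iInf_lt_iff.1 hπ
    have hm : Measurable fun q : Sample P × Sample P => ENNReal.ofReal (S q.2) :=
      (hSm.comp measurable_snd).ennreal_ofReal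
    have e1 : ∫⁻ q, ENNReal.ofReal (S q.2) ∂π =
        ENNReal.ofReal (1 / (p.numSamples g : ℝ) * ∑ n, S (p.sample g n)) := by
      rw [ofReal_one_div_mul_sum (hp.numSamples_pos g) fun n => hS0 _,
        ← lintegral_empirical _ hSm.ennreal_ofReal, ← h2,
        lintegral_map hSm.ennreal_ofReal measurable_snd]
    calc ∫⁻ ξ, ENNReal.ofReal (hinge w ξ) ∂Q
        = ∫⁻ q, ENNReal.ofReal (hinge w q.1) ∂π := by
          rw [← h1, lintegral_map (measurable_hinge w).ennreal_ofReal measurable_fst]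
      _ ≤ ∫⁻ q, (ENNReal.ofReal (S q.2) +
            ENNReal.ofReal l * ENNReal.ofReal (cost p.ν (p.κ g) q.1 q.2)) ∂π := by
          refine lintegral_mono fun q => ?_
          rw [← ENNReal.ofReal_mul hl0, ← ENNReal.ofReal_add (hS0 _)
            (mul_nonneg hl0 (cost_nonneg _ (hp.κ_nonneg g) _ _))]
          exact ENNReal.ofReal_le_ofReal
            (hinge_le_add_mul_cost hp.norm_definite w (p.κ g) hl q.1 q.2)
      _ = ENNReal.ofReal (1 / (p.numSamples g : ℝ) * ∑ n, S (p.sample g n)) +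
            ENNReal.ofReal l * ∫⁻ q, ENNReal.ofReal (cost p.ν (p.κ g) q.1 q.2) ∂π := by
          rw [lintegral_add_left hm, e1, lintegral_const_mul _ (measurable_cost _ _).ennreal_ofReal]
      _ ≤ ENNReal.ofReal (1 / (p.numSamples g : ℝ) * ∑ n, S (p.sample g n)) +
            ENNReal.ofReal l * ENNReal.ofReal (p.ε g + η) := by gcongr
      _ = ENNReal.ofReal (p.dualObjective g w l + l * η) := by
          rw [← ENNReal.ofReal_mul hl0, ← ENNReal.ofReal_add]
          · congr 1
            simp only [Problem.dualObjective, hS]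
            ring
          · exact mul_nonneg (by positivity) (Finset.sum_nonneg fun n _ => hS0 _)
          · exact mul_nonneg hl0 (by linarith [hp.ε_nonneg g])
  have hlim : Tendsto (fun η : ℝ => ENNReal.ofReal (p.dualObjective g w l + l * η)) (𝓝[>] 0)
      (𝓝 (ENNReal.ofReal (p.dualObjective g w l + l * 0))) :=
    ((ENNReal.continuous_ofReal.comp (by fun_prop : Continuous fun η : ℝ =>
      p.dualObjective g w l + l * η)).tendsto 0).mono_left nhdsWithin_le_nhds
  rw [mul_zero, add_zero] at hlim
  exact ge_of_tendsto hlim (eventually_mem_nhdsWithin.mono step)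

/-- A distribution obtained by splitting the mass of each sample `n` into the fractions `c n k` and
moving them to the points `z n k` is in the ball if the average cost is at most the radius. -/
theorem Problem.IsRegular.exists_mem_localBall_of_split (hp : p.IsRegular) {K : Type*} [Fintype K]
    (c : Fin (p.numSamples g) → K → ℝ) (z : Fin (p.numSamples g) → K → Sample P)
    (hc : ∀ n k, 0 ≤ c n k) (hc1 : ∀ n, ∑ k, c n k = 1)
    (hcost : 1 / (p.numSamples g : ℝ) *
      ∑ n, ∑ k, c n k * cost p.ν (p.κ g) (z n k) (p.sample g n) ≤ p.ε g) :
    ∃ Q ∈ p.localBall g, ∀ w : Feature P, ∫⁻ ξ, ENNReal.ofReal (hinge w ξ) ∂Q =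
      ENNReal.ofReal (1 / (p.numSamples g : ℝ) * ∑ n, ∑ k, c n k * hinge w (z n k)) := by
  have hN := hp.numSamples_pos g
  set π : Measure (Sample P × Sample P) := (p.numSamples g : ℝ≥0∞)⁻¹ •
    ∑ n, ∑ k, ENNReal.ofReal (c n k) • Measure.dirac (z n k, p.sample g n) with hπ
  have hint : ∀ f : Sample P × Sample P → ℝ, Measurable f → (∀ q, 0 ≤ f q) →
      ∫⁻ q, ENNReal.ofReal (f q) ∂π = ENNReal.ofReal (1 / (p.numSamples g : ℝ) *
        ∑ n, ∑ k, c n k * f (z n k, p.sample g n)) := by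
    intro f hf hf0
    rw [ofReal_one_div_mul_sum hN fun n => Finset.sum_nonneg fun k _ => mul_nonneg (hc n k) (hf0 _)]
    simp only [hπ, lintegral_smul_measure, lintegral_finsetSum_measure,
      lintegral_dirac' _ hf.ennreal_ofReal, smul_eq_mul]
    congr 1
    refine Finset.sum_congr rfl fun n _ => ?_
    rw [ENNReal.ofReal_sum_of_nonneg fun k _ => mul_nonneg (hc n k) (hf0 _)]
    exact Finset.sum_congr rfl fun k _ => (ENNReal.ofReal_mul (hc n k)).symm
  have hsnd : π.map Prod.snd = empirical (p.sample g) := by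
    simp only [hπ, empirical, Measure.map_smul]
    rw [Measure.map_finset_sum measurable_snd.aemeasurable]
    congr 1
    refine Finset.sum_congr rfl fun n _ => ?_
    rw [Measure.map_finset_sum measurable_snd.aemeasurable]
    simp only [Measure.map_smul, Measure.map_dirac' measurable_snd]
    rw [← Finset.sum_smul, ← ENNReal.ofReal_sum_of_nonneg fun k _ => hc n k, hc1,
      ENNReal.ofReal_one, one_smul]
  refine ⟨π.map Prod.fst, ⟨⟨?_⟩, ?_⟩, fun w => ?_⟩
  · rw [Measure.map_apply measurable_fst MeasurableSet.univ, Set.preimage_univ, ← lintegral_one]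
    have := hint (fun _ => 1) measurable_const fun _ => zero_le_one
    simp only [ENNReal.ofReal_one] at this
    rw [this]
    simp [hc1, hN.ne']
  · refine (iInf₂_le π ⟨rfl, hsnd⟩).trans ?_
    rw [hint _ (measurable_cost p.ν (p.κ g)) fun q => cost_nonneg _ (hp.κ_nonneg g) _ _]
    exact ENNReal.ofReal_le_ofReal hcost
  · rw [lintegral_map (measurable_hinge w).ennreal_ofReal measurable_fst,
      hint (fun q => hinge w q.1) ((measurable_hinge w).comp measurable_fst)
        fun q => hinge_nonneg _ _]

theorem Problem.IsRegular.localBall_nonempty (hp : p.IsRegular) (g : Fin G) :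
    (p.localBall g).Nonempty := by
  obtain ⟨Q, hQ, -⟩ := hp.exists_mem_localBall_of_split (g := g) (K := Unit) (fun _ _ => 1)
    (fun n _ => p.sample g n) (fun _ _ => zero_le_one) (fun _ => by simp)
    (by simpa [cost] using hp.ε_nonneg g)
  exact ⟨Q, hQ⟩

theorem le_worstRisk {A : Set (Measure (Sample P))} {Q : Measure (Sample P)} (hQ : Q ∈ A)
    (w : Feature P) : ∫⁻ ξ, ENNReal.ofReal (hinge w ξ) ∂Q ≤ worstRisk A w :=
  le_iSup₂ (f := fun Q (_ : Q ∈ A) => ∫⁻ ξ, ENNReal.ofReal (hinge w ξ) ∂Q) Q hQ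

/-- Distributions attaining the dual bound in the limit `a → 0`: each sample's label is flipped with
probability `θ n`, and then a fraction `a` of the mass is moved by the distance `δ / a` in a
direction that is steepest for the hinge loss, where `δ` is the budget left by the flips. -/
theorem Problem.IsRegular.le_worstRisk_of_fraction (hp : p.IsRegular)
    (w : Feature P) {θ : Fin (p.numSamples g) → ℝ} (hθ : ∀ n, 0 ≤ θ n ∧ θ n ≤ 1)
    (hδ : 0 ≤ p.ε g - p.κ g * (1 / (p.numSamples g : ℝ) * ∑ n, θ n)) :
    ENNReal.ofReal (1 / (p.numSamples g : ℝ) * ∑ n, ((1 - θ n) * hinge w (p.sample g n) +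
        θ n * hinge w ((p.sample g n).1, -(p.sample g n).2)) +
      dualNorm p.ν w * (p.ε g - p.κ g * (1 / (p.numSamples g : ℝ) * ∑ n, θ n))) ≤
      worstRisk (p.localBall g) w := by
  obtain ⟨u, hu, hwu⟩ := exists_inner_eq_dualNorm hp.norm_definite w
  set δ := p.ε g - p.κ g * (1 / (p.numSamples g : ℝ) * ∑ n, θ n) with hδdef
  have hN : (p.numSamples g : ℝ) ≠ 0 := by exact_mod_cast (hp.numSamples_pos g).ne'
  -- The affine part of the hinge loss, which bounds the loss of the moved mass from below.
  set A : Fin (p.numSamples g) → ℝ := fun n =>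
    1 - (((p.sample g n).2 : ℤ) : ℝ) * inner ℝ w (p.sample g n).1 with hA
  set B : Fin (p.numSamples g) → ℝ := fun n =>
    1 + (((p.sample g n).2 : ℤ) : ℝ) * inner ℝ w (p.sample g n).1 with hB
  set R : ℝ → ℝ := fun a => 1 / (p.numSamples g : ℝ) * ∑ n,
    ((1 - a) * ((1 - θ n) * hinge w (p.sample g n) +
        θ n * hinge w ((p.sample g n).1, -(p.sample g n).2)) +
      a * ((1 - θ n) * A n + θ n * B n)) + dualNorm p.ν w * δ with hR
  have step : ∀ a ∈ Set.Ioc (0 : ℝ) 1, ENNReal.ofReal (R a) ≤ worstRisk (p.localBall g) w := by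
    rintro a ⟨ha0, ha1⟩
    set lab : Fin (p.numSamples g) → Bool → ℤˣ :=
      fun n i => if i then -(p.sample g n).2 else (p.sample g n).2 with hlab
    set z : Fin (p.numSamples g) → Bool × Bool → Sample P := fun n k =>
      ((p.sample g n).1 + (if k.2 then -((((lab n k.1 : ℤˣ) : ℤ) : ℝ) * (δ / a)) else 0) • u,
        lab n k.1) with hz
    set c : Fin (p.numSamples g) → Bool × Bool → ℝ := fun n k =>
      (if k.1 then θ n else 1 - θ n) * (if k.2 then a else 1 - a) with hc
    have hδa : 0 ≤ δ / a := by positivity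
    have cost_le : ∀ n k, cost p.ν (p.κ g) (z n k) (p.sample g n) ≤
        (if k.2 then δ / a else 0) + p.κ g * (if k.1 then 1 else 0) := by
      rintro n ⟨i, j⟩
      refine add_le_add ?_ (mul_le_mul_of_nonneg_left ?_ (hp.κ_nonneg g))
      · simp only [hz, add_sub_cancel_left, map_smul_eq_mul]
        cases j
        · simp
        · simp only [if_true, norm_neg, norm_mul, Real.norm_eq_abs, abs_label, one_mul,
            abs_of_nonneg hδa]
          exact mul_le_of_le_one_right hδa hu
      · cases i <;> simp only [hz, hlab] <;> split_ifs <;> simp_all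
    have hc0 : ∀ n k, 0 ≤ c n k := by
      rintro n ⟨i, j⟩
      refine mul_nonneg ?_ ?_
      · dsimp only; split_ifs
        · exact (hθ n).1
        · linarith [(hθ n).2]
      · dsimp only; split_ifs <;> linarith
    have hcost : 1 / (p.numSamples g : ℝ) *
        ∑ n, ∑ k, c n k * cost p.ν (p.κ g) (z n k) (p.sample g n) ≤ p.ε g := by
      have h1 : ∀ n, ∑ k, c n k * cost p.ν (p.κ g) (z n k) (p.sample g n) ≤
          δ + p.κ g * θ n := by
        intro n
        refine (Finset.sum_le_sum fun k _ =>
          mul_le_mul_of_nonneg_left (cost_le n k) (hc0 n k)).trans_eq ?_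
        simp only [hc, Fintype.sum_prod_type, Fintype.sum_bool, if_true, if_false,
          Bool.false_eq_true]
        field_simp
        ring
      calc 1 / (p.numSamples g : ℝ) *
            ∑ n, ∑ k, c n k * cost p.ν (p.κ g) (z n k) (p.sample g n)
          ≤ 1 / (p.numSamples g : ℝ) * ∑ n, (δ + p.κ g * θ n) :=
            mul_le_mul_of_nonneg_left (Finset.sum_le_sum fun n _ => h1 n) (by positivity)
        _ = δ + p.κ g * (1 / (p.numSamples g : ℝ) * ∑ n, θ n) := by
            rw [Finset.sum_add_distrib, ← Finset.mul_sum, Finset.sum_const, Finset.card_univ,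
              Fintype.card_fin, nsmul_eq_mul]
            field_simp
        _ = p.ε g := by rw [hδdef]; ring
    obtain ⟨Q, hQ, hQw⟩ := hp.exists_mem_localBall_of_split (g := g) c z hc0
      (by intro n; simp [hc, Fintype.sum_prod_type]; ring) hcost
    refine le_trans ?_ (le_worstRisk hQ w)
    rw [hQw]
    refine ENNReal.ofReal_le_ofReal ?_
    have hstay : ∀ n i, z n (i, false) = ((p.sample g n).1, lab n i) := by
      intro n i; simp [hz]
    have hmove : ∀ n i, 1 - (((lab n i : ℤˣ) : ℤ) : ℝ) * inner ℝ w (p.sample g n).1 +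
        δ / a * dualNorm p.ν w ≤ hinge w (z n (i, true)) := by
      intro n i
      refine le_trans (le_of_eq ?_) (le_max_right _ _)
      simp only [hz, if_true, inner_add_right, inner_smul_right, hwu]
      linear_combination (-(δ / a * dualNorm p.ν w)) * label_mul_self (lab n i)
    have h1 : ∀ n, (1 - a) * ((1 - θ n) * hinge w (p.sample g n) +
        θ n * hinge w ((p.sample g n).1, -(p.sample g n).2)) +
        a * ((1 - θ n) * A n + θ n * B n) + dualNorm p.ν w * δ ≤
        ∑ k, c n k * hinge w (z n k) := by
      intro n
      have hf := mul_le_mul_of_nonneg_left (hmove n false) (hc0 n (false, true))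
      have ht := mul_le_mul_of_nonneg_left (hmove n true) (hc0 n (true, true))
      have e : dualNorm p.ν w * δ = a * (δ / a * dualNorm p.ν w) := by field_simp
      rw [e]
      simp only [hc, hlab, Fintype.sum_prod_type, Fintype.sum_bool, if_true, if_false,
        Bool.false_eq_true, hstay, hA, hB, Units.val_neg, Int.cast_neg] at hf ht ⊢
      linarith
    calc R a = 1 / (p.numSamples g : ℝ) * ∑ n, ((1 - a) * ((1 - θ n) * hinge w (p.sample g n) +
            θ n * hinge w ((p.sample g n).1, -(p.sample g n).2)) +
            a * ((1 - θ n) * A n + θ n * B n) + dualNorm p.ν w * δ) := by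
          rw [Finset.sum_add_distrib, Finset.sum_const, Finset.card_univ, Fintype.card_fin,
            nsmul_eq_mul]
          simp only [hR]
          field_simp
      _ ≤ _ := mul_le_mul_of_nonneg_left (Finset.sum_le_sum fun n _ => h1 n) (by positivity)
  have hlim : Tendsto (fun a : ℝ => ENNReal.ofReal (R a)) (𝓝[>] 0) (𝓝 (ENNReal.ofReal (R 0))) :=
    ((ENNReal.continuous_ofReal.comp (by fun_prop : Continuous R)).tendsto 0).mono_left
      nhdsWithin_le_nhds
  have hR0 : R 0 = 1 / (p.numSamples g : ℝ) * ∑ n, ((1 - θ n) * hinge w (p.sample g n) +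
        θ n * hinge w ((p.sample g n).1, -(p.sample g n).2)) + dualNorm p.ν w * δ := by
    simp [hR]
  rw [← hR0]
  exact le_of_tendsto hlim (Filter.mem_of_superset (Ioc_mem_nhdsGT zero_lt_one) step)

theorem Problem.IsRegular.worstRisk_localBall (hp : p.IsRegular) (g : Fin G) (w : Feature P) :
    worstRisk (p.localBall g) w = ENNReal.ofReal (p.robustLoss g w) := by
  obtain ⟨l, hl, h⟩ := hp.exists_robustLoss_eq g w
  refine le_antisymm (h ▸ hp.worstRisk_localBall_le hl) ?_
  obtain ⟨θ, hθ, hδ, heq⟩ := exists_fraction_of_isMinOn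
    (fun n => hinge w (p.sample g n)) (fun n => hinge w ((p.sample g n).1, -(p.sample g n).2))
    hl (fun l' hl' => h.symm.trans_le (hp.robustLoss_le hl')) (hp.κ_nonneg g)
  rw [h, Problem.dualObjective, heq]
  exact hp.le_worstRisk_of_fraction w hθ hδ

/-- The clients' distributions vary independently in a mixture, so the supremum of the mixture risk
is the mixture of the suprema. -/
theorem Problem.IsRegular.worstRisk_mixtureBall (hp : p.IsRegular) (w : Feature P) :
    worstRisk p.mixtureBall w =
      ∑ g, ENNReal.ofReal (p.α g) * worstRisk (p.localBall g) w := by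
  have hint : ∀ q : Fin G → Measure (Sample P),
      ∫⁻ ξ, ENNReal.ofReal (hinge w ξ) ∂(∑ g, ENNReal.ofReal (p.α g) • q g) =
        ∑ g, ENNReal.ofReal (p.α g) * ∫⁻ ξ, ENNReal.ofReal (hinge w ξ) ∂(q g) := by
    intro q
    simp only [lintegral_finsetSum_measure, lintegral_smul_measure, smul_eq_mul]
  refine le_antisymm (iSup₂_le ?_) ?_
  · rintro _ ⟨q, hq, rfl⟩
    rw [hint]
    exact Finset.sum_le_sum fun g _ => mul_le_mul_right (le_worstRisk (hq g) w) _
  · have hne : ∀ g, Nonempty (p.localBall g) := fun g => (hp.localBall_nonempty g).to_subtype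
    have hsup : ∀ g, ENNReal.ofReal (p.α g) * worstRisk (p.localBall g) w =
        ⨆ q : (∀ g, p.localBall g),
          ENNReal.ofReal (p.α g) * ∫⁻ ξ, ENNReal.ofReal (hinge w ξ) ∂(q g).1 := by
      intro g
      rw [worstRisk, iSup_subtype', ENNReal.mul_iSup]
      exact ((Function.surjective_eval (β := fun g => p.localBall g) g).iSup_comp (fun Q : p.localBall g =>
        ENNReal.ofReal (p.α g) * ∫⁻ ξ, ENNReal.ofReal (hinge w ξ) ∂Q.1)).symm
    simp only [hsup]
    rw [ENNReal.finsetSum_iSup]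
    · refine iSup_le fun q => ?_
      rw [← hint fun g => (q g).1]
      exact le_worstRisk (A := p.mixtureBall) ⟨fun g => (q g).1, fun g => (q g).2, rfl⟩ w
    · intro q q'
      classical
      refine ⟨fun g => if ∫⁻ ξ, ENNReal.ofReal (hinge w ξ) ∂(q g).1 ≤
        ∫⁻ ξ, ENNReal.ofReal (hinge w ξ) ∂(q' g).1 then q' g else q g, fun g => ?_⟩
      dsimp only
      split_ifs with h
      · exact ⟨mul_le_mul_right h _, le_rfl⟩
      · exact ⟨le_rfl, mul_le_mul_right (not_le.1 h).le _⟩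

/-! ### Optimality conditions -/

section Hilbert

variable {E : Type*} [NormedAddCommGroup E] [InnerProductSpace ℝ E]

/-- First-order condition at a minimizer `v` of `f + τ ‖·‖² + ρ / 2 ‖· - c‖²`: the vector
`-ρ (v - c)` is a subgradient of `f + τ ‖·‖²` at `v`, with the quadratic gain of strong convexity. -/
theorem le_of_isMinOn_prox {f : E → ℝ} (hf : ConvexOn ℝ Set.univ f) {v c : E} {ρ τ : ℝ}
    (hmin : ∀ u, f v + ρ / 2 * ‖v - c‖ ^ 2 + τ * ‖v‖ ^ 2 ≤
      f u + ρ / 2 * ‖u - c‖ ^ 2 + τ * ‖u‖ ^ 2) (u : E) :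
    f v + τ * ‖v‖ ^ 2 - ρ * inner ℝ (v - c) (u - v) + τ * ‖u - v‖ ^ 2 ≤
      f u + τ * ‖u‖ ^ 2 := by
  set d := u - v with hd
  have hu : u = v + d := by simp [hd]
  -- Compare `v` with `v + t • d` and let `t` tend to `0`.
  have step : ∀ t ∈ Set.Ioc (0 : ℝ) 1, 0 ≤ f u - f v + ρ * inner ℝ (v - c) d +
      2 * τ * inner ℝ v d + t * ((ρ / 2 + τ) * ‖d‖ ^ 2) := by
    rintro t ⟨ht0, ht1⟩
    have h1 := hmin (v + t • d)
    have h2 : f (v + t • d) ≤ (1 - t) * f v + t * f u := by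
      have := hf.2 (Set.mem_univ v) (Set.mem_univ u) (sub_nonneg.2 ht1) ht0.le (by ring)
      rwa [show (1 - t) • v + t • u = v + t • d by rw [hu]; module] at this
    have h3 : ‖v + t • d - c‖ ^ 2 =
        ‖v - c‖ ^ 2 + 2 * (t * inner ℝ (v - c) d) + t ^ 2 * ‖d‖ ^ 2 := by
      rw [show v + t • d - c = (v - c) + t • d by abel, norm_add_sq_real, inner_smul_right,
        norm_smul, mul_pow, Real.norm_eq_abs, sq_abs]
    have h4 : ‖v + t • d‖ ^ 2 = ‖v‖ ^ 2 + 2 * (t * inner ℝ v d) + t ^ 2 * ‖d‖ ^ 2 := by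
      rw [norm_add_sq_real, inner_smul_right, norm_smul, mul_pow, Real.norm_eq_abs, sq_abs]
    rw [h3, h4] at h1
    refine nonneg_of_mul_nonneg_right (a := t) ?_ ht0
    nlinarith
  have hlim : Tendsto (fun t : ℝ => f u - f v + ρ * inner ℝ (v - c) d +
      2 * τ * inner ℝ v d + t * ((ρ / 2 + τ) * ‖d‖ ^ 2)) (𝓝[>] 0)
      (𝓝 (f u - f v + ρ * inner ℝ (v - c) d +
      2 * τ * inner ℝ v d + 0 * ((ρ / 2 + τ) * ‖d‖ ^ 2))) :=
    (Continuous.tendsto (by fun_prop) 0).mono_left nhdsWithin_le_nhds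
  have h0 := ge_of_tendsto hlim (Filter.mem_of_superset (Ioc_mem_nhdsGT zero_lt_one) step)
  have h5 : ‖u‖ ^ 2 = ‖v‖ ^ 2 + 2 * inner ℝ v d + ‖d‖ ^ 2 := by rw [hu, norm_add_sq_real]
  rw [h5]
  linarith

/-- Lagrange multipliers of the consensus constraint: at a minimizer of a weighted sum of convex
functions there are subgradients of the summands whose weighted sum vanishes. They come from
separating the strict epigraph of the separable objective on `Fin G → E` from the graph of its
optimal value over the diagonal. -/
theorem exists_subgradients_sum_eq_zero [CompleteSpace E] {F : Fin G → E → ℝ}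
    (hF : ∀ g, ConvexOn ℝ Set.univ (F g)) (hFc : ∀ g, Continuous (F g)) {α : Fin G → ℝ}
    (hα : ∀ g, 0 < α g) {x : E} (hx : ∀ u, ∑ g, α g * F g x ≤ ∑ g, α g * F g u) :
    ∃ y : Fin G → E, ∑ g, α g • y g = 0 ∧
      ∀ g u, F g x + inner ℝ (y g) (u - x) ≤ F g u := by
  set Φ : (Fin G → E) → ℝ := fun u => ∑ g, α g * F g (u g) with hΦ
  have hΦc : Continuous Φ :=
    continuous_finsetSum _ fun g _ => ((hFc g).comp (continuous_apply g)).const_mul _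
  have hΦconv : ConvexOn ℝ Set.univ Φ := by
    refine ⟨convex_univ, fun u _ v _ a b ha hb hab => ?_⟩
    simp only [hΦ, smul_eq_mul]
    rw [Finset.mul_sum, Finset.mul_sum, ← Finset.sum_add_distrib]
    refine Finset.sum_le_sum fun g _ => ?_
    have := mul_le_mul_of_nonneg_left
      ((hF g).2 (Set.mem_univ (u g)) (Set.mem_univ (v g)) ha hb hab) (hα g).le
    simp only [smul_eq_mul] at this
    simp only [Pi.add_apply, Pi.smul_apply]
    linarith
  set m := ∑ g, α g * F g x with hm
  obtain ⟨φ, r, hlt, hge⟩ := geometric_hahn_banach_open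
    (s := {q : (Fin G → E) × ℝ | q.1 ∈ Set.univ ∧ Φ q.1 < q.2})
    (t := {q : (Fin G → E) × ℝ | ∃ u : E, q = (fun _ => u, m)})
    hΦconv.convex_strict_epigraph
    (by simpa using isOpen_lt (hΦc.comp continuous_fst) continuous_snd)
    (by
      rintro _ ⟨u, rfl⟩ _ ⟨v, rfl⟩ a b _ _ hab
      refine ⟨a • u + b • v, Prod.ext rfl ?_⟩
      simp only [Prod.snd_add, Prod.smul_snd, smul_eq_mul]
      rw [← add_mul, hab, one_mul])
    (by
      refine Set.disjoint_left.2 ?_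
      rintro _ ⟨-, h⟩ ⟨u, rfl⟩
      exact absurd h (not_lt.2 (hx u)))
  set ψ : (Fin G → E) →ₗ[ℝ] ℝ := φ.toLinearMap ∘ₗ LinearMap.inl ℝ (Fin G → E) ℝ with hψ
  set c : ℝ := φ (0, 1) with hc
  have hφ : ∀ u s, φ (u, s) = ψ u + s * c := by
    intro u s
    have : ((u, s) : (Fin G → E) × ℝ) = (u, 0) + s • (0, 1) := by simp
    rw [this, map_add, map_smul]
    simp [hψ, hc]
  have hψc : Continuous ψ :=
    φ.continuous.comp (by fun_prop : Continuous fun u : Fin G → E => (u, (0 : ℝ)))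
  have hr : ∀ u : E, r ≤ ψ (fun _ => u) + m * c := fun u => hφ _ _ ▸ hge _ ⟨u, rfl⟩
  have hcneg : c < 0 := by
    have h1 := hlt (fun _ => x, m + 1) ⟨trivial, by simp [hΦ, hm]⟩
    rw [hφ] at h1
    linarith [hr x]
  -- A linear functional that is bounded below vanishes.
  have hdiag : ∀ u : E, ψ (fun _ => u) = 0 := by
    intro u
    by_contra hne
    have h1 := hr (((r - m * c - 1) / ψ (fun _ => u)) • u)
    have h2 : (fun _ : Fin G => ((r - m * c - 1) / ψ (fun _ => u)) • u) =
      ((r - m * c - 1) / ψ (fun _ => u)) • (fun _ : Fin G => u) := rfl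
    rw [h2, map_smul, smul_eq_mul, div_mul_cancel₀ _ hne] at h1
    linarith
  have hsub : ∀ u, ψ u + c * Φ u ≤ c * m := by
    intro u
    have h1 : ∀ δ > 0, ψ u + c * Φ u ≤ c * m + δ := by
      intro δ hδ
      have h2 := hlt (u, Φ u + δ / -c) ⟨trivial, by
        have : 0 < δ / -c := div_pos hδ (by linarith)
        dsimp only; linarith⟩
      rw [hφ] at h2
      have h3 := hr 0
      rw [hdiag] at h3
      have h4 : δ / -c * c = -δ := by rw [div_neg, neg_mul, div_mul_cancel₀ _ hcneg.ne]
      nlinarith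
    exact le_of_forall_pos_le_add h1
  -- The functional on the `g`-th coordinate, rescaled, is the required subgradient.
  set L : Fin G → StrongDual ℝ E := fun g =>
    ⟨(-(c * α g))⁻¹ • (ψ ∘ₗ LinearMap.single ℝ (fun _ : Fin G => E) g), 
      (hψc.comp (continuous_single (A := fun _ : Fin G => E) g)).const_smul _⟩ with hL
  have hLapp : ∀ g u, inner ℝ ((InnerProductSpace.toDual ℝ E).symm (L g)) u =
      (-(c * α g))⁻¹ * ψ (Pi.single g u) := by
    intro g u
    rw [InnerProductSpace.toDual_symm_apply]
    rfl
  refine ⟨fun g => (InnerProductSpace.toDual ℝ E).symm (L g), ?_, fun g u => ?_⟩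
  · refine ext_inner_right ℝ fun u => ?_
    rw [sum_inner, inner_zero_left]
    have h1 : ∀ g, inner ℝ (α g • (InnerProductSpace.toDual ℝ E).symm (L g)) u =
        (-c)⁻¹ * ψ (Pi.single g u) := by
      intro g
      rw [real_inner_smul_left, hLapp]
      have := (hα g).ne'
      have := hcneg.ne
      field_simp
    simp only [h1]
    rw [← Finset.mul_sum, ← map_sum, Finset.univ_sum_single (fun _ : Fin G => u), hdiag, mul_zero]
  · have h1 := hsub (Function.update (fun _ => x) g u)
    have h2 : Φ (Function.update (fun _ => x) g u) = m + α g * (F g u - F g x) := by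
      have h3 : ∀ i, α i * F i (Function.update (fun _ => x) g u i) =
          α i * F i x + if i = g then α g * (F g u - F g x) else 0 := by
        intro i
        by_cases hi : i = g
        · subst hi; simp; ring
        · simp [hi]
      simp only [hΦ, h3, Finset.sum_add_distrib, hm]
      simp
    have h4 : ψ (Function.update (fun _ => x) g u) = ψ (Pi.single g (u - x)) := by
      have : Function.update (fun _ : Fin G => x) g u = (fun _ => x) + Pi.single g (u - x) := by
        ext1 i
        by_cases hi : i = g
        · subst hi; simp
        · simp [hi]
      rw [this, map_add, hdiag, zero_add]
    rw [h2, h4] at h1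
    rw [hLapp, inv_mul_eq_div]
    have hpos : 0 < -(c * α g) := by nlinarith [hα g]
    have h5 : ψ (Pi.single g (u - x)) / -(c * α g) ≤ F g u - F g x := by
      rw [div_le_iff₀ hpos]
      linarith
    linarith

/-! ### Convergence of the iteration -/

/-- Consensus ADMM in the `α`-weighted inner product converges for every `ρ > 0`. With
`V t = ∑ g, α g * ‖μ t g + y g / ρ‖² + ‖w t - x‖²`, monotonicity of the subgradients gives
`V (t + 1) + (2 / ρ) ∑ g, α g * τ g * ‖v (t + 1) g - x‖² ≤ V t` as soon as the weighted sum of the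
multipliers vanishes, which holds from the first round on. -/
theorem tendsto_of_consensus_iteration {f : Fin G → E → ℝ}
    (hf : ∀ g, ConvexOn ℝ Set.univ (f g)) {α τ : Fin G → ℝ} (hα : ∀ g, 0 < α g)
    (hα_sum : ∑ g, α g = 1) (hτ : ∀ g, 0 < τ g) {ρ : ℝ} (hρ : 0 < ρ)
    {w : ℕ → E} {v μ : ℕ → Fin G → E}
    (hclient : ∀ t g u, f g (v (t + 1) g) + ρ / 2 * ‖v (t + 1) g - (w t - μ t g)‖ ^ 2 +
      τ g * ‖v (t + 1) g‖ ^ 2 ≤ f g u + ρ / 2 * ‖u - (w t - μ t g)‖ ^ 2 + τ g * ‖u‖ ^ 2)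
    (hserver : ∀ t, w (t + 1) = ∑ g, α g • (v (t + 1) g + μ t g))
    (hmult : ∀ t g, μ (t + 1) g = μ t g + v (t + 1) g - w (t + 1))
    {x : E} {y : Fin G → E} (hy : ∑ g, α g • y g = 0)
    (hsub : ∀ g u, f g x + τ g * ‖x‖ ^ 2 + inner ℝ (y g) (u - x) ≤ f g u + τ g * ‖u‖ ^ 2) :
    Tendsto w atTop (𝓝 x) ∧ ∀ g, Tendsto (fun t => v t g) atTop (𝓝 x) := by
  have hμ : ∀ t, ∑ g, α g • μ (t + 1) g = 0 := by
    intro t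
    simp only [hmult, smul_sub, Finset.sum_sub_distrib, ← Finset.sum_smul, hα_sum, one_smul]
    rw [sub_eq_zero, hserver]
    exact Finset.sum_congr rfl fun g _ => by rw [add_comm]
  have hwv : ∀ t, w (t + 2) = ∑ g, α g • v (t + 2) g := by
    intro t
    rw [hserver (t + 1)]
    simp only [smul_add, Finset.sum_add_distrib, hμ, add_zero]
  set V : ℕ → ℝ := fun t =>
    ∑ g, α g * ‖μ (t + 1) g + ρ⁻¹ • y g‖ ^ 2 + ‖w (t + 1) - x‖ ^ 2 with hV
  set D : ℕ → ℝ := fun t => ∑ g, α g * τ g * ‖v (t + 2) g - x‖ ^ 2 with hD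
  have descent : ∀ t, V (t + 1) + 2 / ρ * D t ≤ V t := by
    intro t
    have hg : ∀ g, α g * ‖μ (t + 2) g + ρ⁻¹ • y g‖ ^ 2 +
        2 / ρ * (α g * τ g * ‖v (t + 2) g - x‖ ^ 2) ≤
        α g * ‖μ (t + 1) g + ρ⁻¹ • y g‖ ^ 2 -
          2 * inner ℝ (w (t + 2) - w (t + 1)) (α g • (v (t + 2) g - x)) -
          2 * inner ℝ (α g • (μ (t + 2) g + ρ⁻¹ • y g)) (w (t + 2) - x) := by
      intro g
      have h1 := le_of_isMinOn_prox (hf g) (hclient (t + 1) g) x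
      have h2 := hsub g (v (t + 2) g)
      set d := v (t + 2) g - x with hd
      set n' := μ (t + 2) g + ρ⁻¹ • y g with hn'
      set n := μ (t + 1) g + ρ⁻¹ • y g with hn
      have e1 : v (t + 2) g - (w (t + 1) - μ (t + 1) g) =
          n' - ρ⁻¹ • y g + (w (t + 2) - w (t + 1)) := by
        rw [hn', hmult (t + 1) g]; abel
      have e2 : n = n' - (d - (w (t + 2) - x)) := by
        rw [hn', hn, hd, hmult (t + 1) g]; abel
      have e3 : x - v (t + 2) g = -d := by rw [hd]; abel
      rw [show t + 1 + 1 = t + 2 from rfl, e1, e3, inner_neg_right, inner_add_left,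
        inner_sub_left, real_inner_smul_left, norm_neg] at h1
      -- Monotonicity of the subgradients at `v (t + 2) g` and at `x`.
      have h3 : τ g * ‖d‖ ^ 2 ≤
          -(ρ * (inner ℝ n' d + inner ℝ (w (t + 2) - w (t + 1)) d)) := by
        have : ρ * (ρ⁻¹ * inner ℝ (y g) d) = inner ℝ (y g) d := by
          rw [mul_inv_cancel_left₀ hρ.ne']
        linarith
      have h4 : ‖n'‖ ^ 2 ≤ ‖n‖ ^ 2 + 2 * inner ℝ n' d - 2 * inner ℝ n' (w (t + 2) - x) := by
        rw [e2, norm_sub_sq_real, inner_sub_right]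
        linarith [sq_nonneg ‖d - (w (t + 2) - x)‖]
      have h5 : 2 / ρ * (τ g * ‖d‖ ^ 2) ≤
          -2 * (inner ℝ n' d + inner ℝ (w (t + 2) - w (t + 1)) d) := by
        rw [div_mul_eq_mul_div, div_le_iff₀ hρ]
        linarith
      rw [real_inner_smul_left, real_inner_smul_right]
      have h6 := mul_le_mul_of_nonneg_left (add_le_add h4 h5) (hα g).le
      linarith
    have hsum := Finset.sum_le_sum fun g (_ : g ∈ Finset.univ) => hg g
    rw [Finset.sum_sub_distrib, Finset.sum_sub_distrib, ← Finset.mul_sum, ← Finset.mul_sum,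
      ← inner_sum, ← sum_inner, Finset.sum_add_distrib, ← Finset.mul_sum] at hsum
    have e1 : ∑ g, α g • (v (t + 2) g - x) = w (t + 2) - x := by
      simp only [smul_sub, Finset.sum_sub_distrib, ← Finset.sum_smul, hα_sum, one_smul, hwv]
    have e2 : ∑ g, α g • (μ (t + 2) g + ρ⁻¹ • y g) = 0 := by
      simp only [smul_add, Finset.sum_add_distrib, hμ (t + 1), zero_add, smul_comm _ ρ⁻¹]
      rw [← Finset.smul_sum, hy, smul_zero]
    rw [e1, e2, inner_zero_left] at hsum
    have h7 : ‖w (t + 2) - x‖ ^ 2 ≤ ‖w (t + 1) - x‖ ^ 2 +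
        2 * inner ℝ (w (t + 2) - w (t + 1)) (w (t + 2) - x) := by
      have : w (t + 1) - x = (w (t + 2) - x) - (w (t + 2) - w (t + 1)) := by abel
      rw [this, norm_sub_sq_real (w (t + 2) - x), real_inner_comm (w (t + 2) - w (t + 1))]
      linarith [sq_nonneg ‖w (t + 2) - w (t + 1)‖]
    simp only [hV, hD]
    linarith
  have hD0 : ∀ t, 0 ≤ D t := fun t => Finset.sum_nonneg fun g _ =>
    mul_nonneg (mul_nonneg (hα g).le (hτ g).le) (sq_nonneg _)
  have hV0 : ∀ t, 0 ≤ V t := fun t => add_nonneg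
    (Finset.sum_nonneg fun g _ => mul_nonneg (hα g).le (sq_nonneg _)) (sq_nonneg _)
  have hanti : Antitone V := antitone_nat_of_succ_le fun t =>
    le_trans (le_add_of_nonneg_right (mul_nonneg (by positivity) (hD0 t))) (descent t)
  have hVlim := tendsto_atTop_ciInf hanti ⟨0, by rintro _ ⟨t, rfl⟩; exact hV0 t⟩
  have hDlim : Tendsto D atTop (𝓝 0) := by
    have h1 : Tendsto (fun t => ρ / 2 * (V t - V (t + 1))) atTop (𝓝 0) := by
      simpa using (hVlim.sub (hVlim.comp (tendsto_add_atTop_nat 1))).const_mul (ρ / 2)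
    refine squeeze_zero hD0 (fun t => ?_) h1
    have h2 := descent t
    have h3 : ρ / 2 * (2 / ρ * D t) = D t := by field_simp
    have h4 := mul_le_mul_of_nonneg_left h2 (by positivity : 0 ≤ ρ / 2)
    linarith
  have hv : ∀ g, Tendsto (fun t => v t g) atTop (𝓝 x) := by
    intro g
    rw [← tendsto_add_atTop_iff_nat 2, tendsto_iff_norm_sub_tendsto_zero]
    have hpos : 0 < α g * τ g := mul_pos (hα g) (hτ g)
    have h1 : Tendsto (fun t => ‖v (t + 2) g - x‖ ^ 2) atTop (𝓝 0) := by
      refine squeeze_zero (fun t => sq_nonneg _) (fun t => ?_)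
        (by simpa using hDlim.div_const (α g * τ g))
      rw [le_div_iff₀ hpos, mul_comm]
      exact Finset.single_le_sum (f := fun g => α g * τ g * ‖v (t + 2) g - x‖ ^ 2)
        (fun g _ => mul_nonneg (mul_nonneg (hα g).le (hτ g).le) (sq_nonneg _)) (Finset.mem_univ g)
    simpa using h1.sqrt
  refine ⟨?_, hv⟩
  rw [← tendsto_add_atTop_iff_nat 2]
  simp only [hwv]
  have h1 : Tendsto (fun t => ∑ g, α g • v (t + 2) g) atTop (𝓝 (∑ g, α g • x)) :=
    tendsto_finsetSum _ fun g _ => ((tendsto_add_atTop_iff_nat 2).2 (hv g)).const_smul (α g)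
  rwa [← Finset.sum_smul, hα_sum, one_smul] at h1

theorem exists_forall_le_of_mul_sq_norm_le [FiniteDimensional ℝ E] {h : E → ℝ} (hc : Continuous h)
    {c : ℝ} (hpos : 0 < c) (hle : ∀ u, c * ‖u‖ ^ 2 ≤ h u) : ∃ v, ∀ u, h v ≤ h u := by
  have : ProperSpace E := FiniteDimensional.proper ℝ E
  refine hc.exists_forall_le (tendsto_atTop_mono hle ?_)
  exact ((tendsto_pow_atTop two_ne_zero).comp
    (tendsto_norm_cocompact_atTop (E := E))).const_mul_atTop hpos

end Hilbert

/-! ### The clients' problems and the objectives -/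

/-- Eliminating `(λ, s)`: the `w_g`-parts of the minimizers of the client problem are the minimizers
of the robust loss plus the quadratic terms. -/
theorem Problem.IsRegular.isClientUpdate_iff (hp : p.IsRegular) {τ : Fin G → ℝ} {ρ : ℝ}
    {w μ v : Feature P} :
    p.IsClientUpdate τ ρ g w μ v ↔ ∀ u, p.robustLoss g v + ρ / 2 * ‖v - (w - μ)‖ ^ 2 +
      τ g * ‖v‖ ^ 2 ≤ p.robustLoss g u + ρ / 2 * ‖u - (w - μ)‖ ^ 2 + τ g * ‖u‖ ^ 2 := by
  have lower : ∀ z ∈ p.clientSet g, p.robustLoss g z.1 + ρ / 2 * ‖z.1 - (w - μ)‖ ^ 2 +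
      τ g * ‖z.1‖ ^ 2 ≤ p.clientObjective τ ρ g w μ z := by
    rintro ⟨u, l, s⟩ ⟨h1, h2, h3⟩
    have h4 := hp.robustLoss_le (g := g) h3
    have h5 : p.dualObjective g u l ≤ l * p.ε g + 1 / (p.numSamples g : ℝ) * ∑ n, s n := by
      unfold Problem.dualObjective
      gcongr with n
      exact max_le (h1 n) (h2 n)
    simp only [Problem.clientObjective, sub_add]
    linarith
  have attained : ∀ u, ∃ l s, (u, l, s) ∈ p.clientSet g ∧
      p.clientObjective τ ρ g w μ (u, l, s) =
        p.robustLoss g u + ρ / 2 * ‖u - (w - μ)‖ ^ 2 + τ g * ‖u‖ ^ 2 := by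
    intro u
    obtain ⟨l, hl, h⟩ := hp.exists_robustLoss_eq g u
    refine ⟨l, fun n => max (hinge u (p.sample g n))
      (hinge u ((p.sample g n).1, -(p.sample g n).2) - p.κ g * l),
      ⟨fun n => le_max_left _ _, fun n => le_max_right _ _, hl⟩, ?_⟩
    simp only [h, Problem.clientObjective, Problem.dualObjective, sub_add]
  constructor
  · rintro ⟨l, s, hz, hmin⟩ u
    obtain ⟨l', s', hz', h'⟩ := attained u
    exact (lower _ hz).trans ((hmin hz').trans_eq h')
  · intro h
    obtain ⟨l, s, hz, h'⟩ := attained v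
    exact ⟨l, s, hz, fun z hz' => (h'.trans_le (h z.1)).trans (lower z hz')⟩

theorem Problem.IsRegular.exists_isClientUpdate (hp : p.IsRegular) {τ : Fin G → ℝ} (hτ : 0 < τ g)
    {ρ : ℝ} (hρ : 0 < ρ) (w μ : Feature P) : ∃ v, p.IsClientUpdate τ ρ g w μ v := by
  simp only [hp.isClientUpdate_iff]
  have := hp.continuous_robustLoss g
  refine exists_forall_le_of_mul_sq_norm_le (c := τ g) (h := fun u => p.robustLoss g u +
    ρ / 2 * ‖u - (w - μ)‖ ^ 2 + τ g * ‖u‖ ^ 2) (by fun_prop) hτ fun u => ?_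
  have := hp.robustLoss_nonneg g u
  have : 0 ≤ ρ / 2 * ‖u - (w - μ)‖ ^ 2 := by positivity
  linarith

theorem Problem.IsRegular.exists_isADMMSC (hp : p.IsRegular) {τ : Fin G → ℝ} (hτ : ∀ g, 0 < τ g)
    {ρ : ℝ} (hρ : 0 < ρ) (w₀ : Feature P) (v₀ μ₀ : Fin G → Feature P) :
    ∃ (w : ℕ → Feature P) (v μ : ℕ → Fin G → Feature P),
      w 0 = w₀ ∧ v 0 = v₀ ∧ μ 0 = μ₀ ∧ p.IsADMMSC τ ρ w v μ := by
  choose c hc using fun g w μ => hp.exists_isClientUpdate (hτ g) hρ w μ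
  let next : Feature P × (Fin G → Feature P) × (Fin G → Feature P) →
      Feature P × (Fin G → Feature P) × (Fin G → Feature P) := fun q =>
    (∑ g, p.α g • (c g q.1 (q.2.2 g) + q.2.2 g), fun g => c g q.1 (q.2.2 g),
      fun g => q.2.2 g + c g q.1 (q.2.2 g) - ∑ g, p.α g • (c g q.1 (q.2.2 g) + q.2.2 g))
  let q : ℕ → Feature P × (Fin G → Feature P) × (Fin G → Feature P) :=
    fun t => Nat.rec (w₀, v₀, μ₀) (fun _ => next) t
  exact ⟨fun t => (q t).1, fun t => (q t).2.1, fun t => (q t).2.2, rfl, rfl, rfl,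
    fun t g => hc g _ _, fun t => rfl, fun t g => rfl⟩

/-- The real-valued form of the modified objective. -/
noncomputable def Problem.regularizedLoss (p : Problem G P) (τ : Fin G → ℝ) (w : Feature P) : ℝ :=
  ∑ g, p.α g * (p.robustLoss g w + τ g * ‖w‖ ^ 2)

theorem Problem.IsRegular.modifiedObjective_eq (hp : p.IsRegular) (hα : ∀ g, 0 ≤ p.α g)
    {τ : Fin G → ℝ} (hτ : ∀ g, 0 < τ g) (w : Feature P) :
    p.modifiedObjective τ w = ENNReal.ofReal (p.regularizedLoss τ w) := by
  have h1 : ∀ g, 0 ≤ τ g * ‖w‖ ^ 2 := fun g => mul_nonneg (hτ g).le (sq_nonneg _)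
  have h2 := fun g => hp.robustLoss_nonneg g w
  rw [Problem.modifiedObjective, hp.worstRisk_mixtureBall, Problem.regularizedLoss,
    ENNReal.ofReal_sum_of_nonneg fun g _ => mul_nonneg (hα g) (add_nonneg (h2 g) (h1 g)),
    ← Finset.sum_add_distrib]
  refine Finset.sum_congr rfl fun g _ => ?_
  rw [hp.worstRisk_localBall, mul_add, ENNReal.ofReal_add (mul_nonneg (hα g) (h2 g))
    (mul_nonneg (hα g) (h1 g)), ENNReal.ofReal_mul (hα g), ENNReal.ofReal_mul (hα g)]

theorem Problem.IsRegular.consensusObjective_eq (hp : p.IsRegular) (hα : ∀ g, 0 ≤ p.α g)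
    {τ : Fin G → ℝ} (hτ : ∀ g, 0 < τ g) {z : (Fin G → Feature P) × Feature P}
    (hz : z ∈ consensusSet G P) :
    p.consensusObjective τ z = ENNReal.ofReal (p.regularizedLoss τ z.2) := by
  have h1 : ∀ g, 0 ≤ τ g * ‖z.2‖ ^ 2 := fun g => mul_nonneg (hτ g).le (sq_nonneg _)
  have h2 := fun g => hp.robustLoss_nonneg g z.2
  rw [Problem.consensusObjective, Problem.regularizedLoss,
    ENNReal.ofReal_sum_of_nonneg fun g _ => mul_nonneg (hα g) (add_nonneg (h2 g) (h1 g))]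
  refine Finset.sum_congr rfl fun g _ => ?_
  rw [sub_eq_zero.1 (hz g), hp.worstRisk_localBall, ENNReal.ofReal_mul (hα g),
    ENNReal.ofReal_add (h2 g) (h1 g)]

theorem Problem.IsRegular.continuous_regularizedLoss (hp : p.IsRegular) (τ : Fin G → ℝ) :
    Continuous (p.regularizedLoss τ) :=
  continuous_finsetSum _ fun g _ => by
    have := hp.continuous_robustLoss g
    fun_prop

/-- Every run converges to a minimizer of the regularized loss, for every `ρ > 0`. -/
theorem Problem.IsRegular.exists_tendsto (hp : p.IsRegular) (hα : ∀ g, 0 < p.α g)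
    (hα_sum : ∑ g, p.α g = 1) {τ : Fin G → ℝ} (hτ : ∀ g, 0 < τ g) {ρ : ℝ} (hρ : 0 < ρ)
    {w : ℕ → Feature P} {v μ : ℕ → Fin G → Feature P} (h : p.IsADMMSC τ ρ w v μ) :
    ∃ x, (∀ u, p.regularizedLoss τ x ≤ p.regularizedLoss τ u) ∧
      Tendsto w atTop (𝓝 x) ∧ ∀ g, Tendsto (fun t => v t g) atTop (𝓝 x) := by
  have hpos : 0 < ∑ g, p.α g * τ g := by
    refine Finset.sum_pos (fun g _ => mul_pos (hα g) (hτ g)) ?_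
    by_contra hne
    rw [Finset.not_nonempty_iff_eq_empty] at hne
    simp [hne] at hα_sum
  obtain ⟨x, hx⟩ := exists_forall_le_of_mul_sq_norm_le (hp.continuous_regularizedLoss τ) hpos
    fun u => by
      rw [Finset.sum_mul]
      refine Finset.sum_le_sum fun g _ => ?_
      rw [mul_assoc]
      exact mul_le_mul_of_nonneg_left (le_add_of_nonneg_left (hp.robustLoss_nonneg g u)) (hα g).le
  have hconv : ∀ g, ConvexOn ℝ Set.univ fun u : Feature P => p.robustLoss g u + τ g * ‖u‖ ^ 2 :=
    fun g => (hp.convexOn_robustLoss g).add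
      (((convexOn_univ_norm (E := Feature P)).pow (fun _ _ => norm_nonneg _) 2).smul (hτ g).le)
  obtain ⟨y, hy, hsub⟩ := exists_subgradients_sum_eq_zero hconv
    (fun g => by have := hp.continuous_robustLoss g; fun_prop) hα hx
  exact ⟨x, hx, tendsto_of_consensus_iteration hp.convexOn_robustLoss hα hα_sum hτ hρ
    (fun t g => hp.isClientUpdate_iff.1 (h.client t g)) h.server h.multiplier hy hsub⟩

end FDRSVM

theorem theorem3 {G P : ℕ} (p : FDRSVM.Problem G P)
    (hN : ∀ g, 0 < p.numSamples g)
    (hα : ∀ g, 0 ≤ p.α g) (hα_sum : ∑ g, p.α g = 1)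
    (hε : ∀ g, 0 ≤ p.ε g) (hκ : ∀ g, 0 ≤ p.κ g)
    (hν : ∀ x, p.ν x = 0 → x = 0)
    (τ : Fin G → ℝ) (hτ : ∀ g, 0 < τ g) (ρ : ℝ) (hρ : 0 < ρ)
    -- the client in position `g : Fin G` is client number `g + 1`
    (hρ_le : ∀ g : Fin G, (g : ℕ) + 1 < G →
      ρ ≤ 4 * p.α g * τ g / (((g : ℝ) + 1) * (2 * (G : ℝ) + 1 - ((g : ℝ) + 1))))
    -- for a single client the last bound reads `+∞`
    (hρ_last : ∀ g : Fin G, (g : ℕ) + 1 = G → 1 < G →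
      ρ ≤ 4 * p.α g * τ g / (((G : ℝ) - 1) * ((G : ℝ) + 2))) :
    -- the algorithm can be run from every starting point
    (∀ (w₀ : FDRSVM.Feature P) (v₀ μ₀ : Fin G → FDRSVM.Feature P),
      ∃ (w : ℕ → FDRSVM.Feature P) (v μ : ℕ → Fin G → FDRSVM.Feature P),
        w 0 = w₀ ∧ v 0 = v₀ ∧ μ 0 = μ₀ ∧ p.IsADMMSC τ ρ w v μ) ∧
    -- and every run converges to an optimal solution of the modified problem
    (∀ (w : ℕ → FDRSVM.Feature P) (v μ : ℕ → Fin G → FDRSVM.Feature P),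
      p.IsADMMSC τ ρ w v μ →
      ∃ wstar : FDRSVM.Feature P,
        IsMinOn (p.modifiedObjective τ) Set.univ wstar ∧
        IsMinOn (p.consensusObjective τ) (FDRSVM.consensusSet G P) (fun _ => wstar, wstar) ∧
        ∀ ε₁ : ℝ, 0 < ε₁ → ∃ T : ℕ, ∀ t, T ≤ t →
          ‖w t - wstar‖ ≤ ε₁ ∧ (∀ g, ‖v t g - wstar‖ ≤ ε₁) ∧
          p.modifiedObjective τ (w t) ≤ p.modifiedObjective τ wstar + ENNReal.ofReal ε₁) := by
  have hp : p.IsRegular := ⟨hN, hε, hκ, hν⟩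
  -- The bounds on `ρ > 0` force every weight to be positive.
  have hα' : ∀ g, 0 < p.α g := by
    intro g
    refine lt_of_le_of_ne (hα g) fun h0 => ?_
    rcases (Nat.succ_le_of_lt g.2).lt_or_eq with hg | hg
    · have := hρ_le g hg
      rw [← h0] at this
      simp only [mul_zero, zero_mul, zero_div] at this
      linarith
    · rcases (Nat.one_le_iff_ne_zero.2 (Nat.pos_iff_ne_zero.1 g.pos)).lt_or_eq with hG | hG
      · have := hρ_last g hg hG
        rw [← h0] at this
        simp only [mul_zero, zero_mul, zero_div] at this
        linarith
      · subst hG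
        rw [Fin.sum_univ_one, Subsingleton.elim 0 g, ← h0] at hα_sum
        exact zero_ne_one hα_sum
  refine ⟨hp.exists_isADMMSC hτ hρ, fun w v μ h => ?_⟩
  obtain ⟨x, hx, hw, hv⟩ := hp.exists_tendsto hα' hα_sum hτ hρ h
  refine ⟨x, fun u _ => ?_, fun z hz => ?_, fun ε₁ hε₁ => ?_⟩
  · rw [Set.mem_ofPred_eq, hp.modifiedObjective_eq hα hτ, hp.modifiedObjective_eq hα hτ]
    exact ENNReal.ofReal_le_ofReal (hx u)
  · rw [Set.mem_ofPred_eq, hp.consensusObjective_eq hα hτ fun g => sub_self x,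
      hp.consensusObjective_eq hα hτ hz]
    exact ENNReal.ofReal_le_ofReal (hx z.2)
  · have hball := Metric.closedBall_mem_nhds x hε₁
    have hF := ((hp.continuous_regularizedLoss τ).tendsto x).comp hw
    have hev := (hw.eventually hball).and ((Filter.eventually_all.2 fun g =>
      (hv g).eventually hball).and (hF.eventually (Iic_mem_nhds (lt_add_of_pos_right _ hε₁))))
    obtain ⟨T, hT⟩ := Filter.eventually_atTop.1 hev
    refine ⟨T, fun t ht => ?_⟩
    obtain ⟨h1, h2, h3⟩ := hT t ht
    refine ⟨mem_closedBall_iff_norm.1 h1, fun g => mem_closedBall_iff_norm.1 (h2 g), ?_⟩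
    rw [hp.modifiedObjective_eq hα hτ, hp.modifiedObjective_eq hα hτ]
    exact (ENNReal.ofReal_le_ofReal h3).trans ENNReal.ofReal_add_le
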